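/- Let $\mathbb{F}=\mathbb{R}$ or $\mathbb{C}$, let $m,n\ge 1$, and let $\underline d=(d_1,\dots,d_m)$ be a list of nonnegative integers, not all zero. Put $D=\sum_{i=1}^m d_i$, $d=\max_i d_i$, $k'=\lceil D/n\rceil$ and $t=nk'-D$, so that $0\le t<n$. **Notation.** $\mathbb{F}[\lambda]^{p\times q}_{e}$ is the set of $p\times q$ polynomial matrices of degree at most $e$, and $\mathbb{F}[\lambda]^{m\times(m+n)}_{\underline d}$ is the set of $m\times(m+n)$ polynomial matrices whose $i$-th row has degree at most $d_i$ for $i=1,\dots,m$, where the degree of a polynomial vector is the highest degree of its entries. For $P(\lambda)=\sum_{j=0}^{e}P_j\lambda^j\in\mathbb{F}[\lambda]^{p\times q}_e$ and $k\ge 1$, the Sylvester matrix $S_k(P)\in\mathbb{F}^{(k+e)p\times kq}$ is the block matrix with $k+e$ block rows and $k$ block columns whose $(r,c)$ block is $P_{r-c}$ if $0\le r-c\le e$ and $0$ otherwise. For $M\in\mathbb{F}[\lambda]^{m\times(m+n)}_{\underline d}$, the trimmed Sylvester matrix $T_k(M)\in\mathbb{F}^{(km+D)\times k(m+n)}$ is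 obtained from $S_k(M)$ (with $e=d$) by deleting, for each $i$, the $i$-th row of each of the last $d-d_i$ block rows (these rows are always zero). $M$ has *full-trimmed-Sylvester-rank* if $\operatorname{rank}T_k(M)=\min\{km+D,\,k(m+n)\}$ for all $k\ge1$. A polynomial matrix is a *minimal basis* if its rows are linearly independent over $\mathbb{F}(\lambda)$ and the sum of their degrees is minimal among all bases, consisting of polynomial vectors, of the $\mathbb{F}(\lambda)$-subspace they span. $M\in\mathbb{F}[\lambda]^{m\times(m+n)}$ and $N\in\mathbb{F}[\lambda]^{n\times(m+n)}$ are *dual minimal bases* if both are minimal bases and $M(\lambda)N(\lambda)^T=0$. $N_{hr}\in\mathbb{F}^{n\times(m+n)}$ is the highest-row-degree coefficient matrix of $N$: its $j$-th row is the coefficient of $\lambda^{\varepsilon_j}$ in the $j$-th row of $N$, where $\varepsilon_j$ is the degree of that row. Finally, $\sigma_1(A)\ge\sigma_2(A)\ge\cdots$ are the singular values of $A$, $\|A\|_2$ is its spectral norm and $\|A\|_F$ its Frobenius norm. **Theorem.** Let $M\in\mathbb{F}[\lambda]^{m\times(m+n)}_{\underline d}$ have full-trimmed-Sylvester-rank and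 let $N\in\mathbb{F}[\lambda]^{n\times(m+n)}_{k'}$ be a minimal basis dual to $M$. Set $$a=\frac{\sigma_{k'm+D}(T_{k'}(M))}{\sqrt{k'}},\qquad b=\frac{\sigma_{k'm+m+D}(T_{k'+1}(M))}{\sqrt{k'+1}},$$ and define $\theta_1(M)$, $\theta_2(M)$ as follows: - if $k'>1$ and $t>0$: $\displaystyle \theta_1(M)=\min\left\{\frac{\sigma_{(k'-1)(m+n)}(T_{k'-1}(M))}{\sqrt{k'-1}},\,a,\,b\right\}$ and $\theta_2(M)=\min\{a,b\}$; - if $k'=1$ and $t>0$: $\theta_1(M)=\theta_2(M)=\min\{a,b\}$; - if $t=0$: $\theta_1(M)=\min\{a,b\}$ and $\theta_2(M)=b$. Then every $\widetilde M\in\mathbb{F}[\lambda]^{m\times(m+n)}_{\underline d}$ such that $$\|T_1(M)-T_1(\widetilde M)\|_2<\frac12\,\theta_1(M)\,\frac{\sigma_n(N_{hr})}{\|S_1(N)\|_F}$$ has full-trimmed-Sylvester-rank and has a dual minimal basis $\widetilde N\in\mathbb{F}[\lambda]^{n\times(m+n)}_{k'}$ that satisfies $$\frac{\|S_1(N)-S_1(\widetilde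 N)\|_F}{\|S_1(N)\|_F}\le\frac{2}{\theta_2(M)}\,\|T_1(M)-T_1(\widetilde M)\|_2 .$$ In addition, if $t=0$, then all the row degrees of $N$ and of $\widetilde N$ are equal to $k'$. -/

import Mathlib

open Polynomial

noncomputable section

namespace TrimmedSylvester

/-- Degree of a polynomial (row) vector: the highest degree of its entries. -/
def vecDegree {F : Type*} [Field F] {q : ℕ} (v : Fin q → F[X]) : ℕ :=
  Finset.univ.sup fun j => (v j).natDegree

/-- A polynomial vector regarded as a vector over the field of rational functions. -/
def toRatVec {F : Type*} [Field F] {q : ℕ} (v : Fin q → F[X]) : Fin q → RatFunc F :=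
  fun j => algebraMap F[X] (RatFunc F) (v j)

/-- The rational subspace spanned by the rows of a polynomial matrix. -/
def rowSpace {F : Type*} [Field F] {p q : ℕ} (P : Matrix (Fin p) (Fin q) F[X]) :
    Submodule (RatFunc F) (Fin q → RatFunc F) :=
  Submodule.span (RatFunc F) (Set.range fun i => toRatVec (P i))

/-- The rows of `P` are linearly independent over the field of rational functions, that is,
`P` has full row (normal) rank. -/
def RowsIndependent {F : Type*} [Field F] {p q : ℕ} (P : Matrix (Fin p) (Fin q) F[X]) : Prop :=
  LinearIndependent (RatFunc F) fun i => toRatVec (P i)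

/-- `P` is a minimal basis: its rows are a basis of the rational subspace they span, and the sum of
their degrees is minimal among all the polynomial bases of that subspace. -/
def IsMinimalBasis {F : Type*} [Field F] {p q : ℕ} (P : Matrix (Fin p) (Fin q) F[X]) : Prop :=
  RowsIndependent P ∧
    ∀ Q : Matrix (Fin p) (Fin q) F[X], RowsIndependent Q → rowSpace Q = rowSpace P →
      ∑ i, vecDegree (P i) ≤ ∑ i, vecDegree (Q i)

/-- `M` and `N` are dual minimal bases: both are minimal bases, their numbers of rows add up to the
common number of columns, and `M Nᵀ = 0`. -/
def DualMinimalBases {F : Type*} [Field F] {m n : ℕ} (M : Matrix (Fin m) (Fin (m + n)) F[X])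
    (N : Matrix (Fin n) (Fin (m + n)) F[X]) : Prop :=
  IsMinimalBasis M ∧ IsMinimalBasis N ∧ M * N.transpose = 0

/-- The polynomial matrices whose `i`-th row has degree at most `d i`. -/
def rowDegreeLE (F : Type*) [Field F] {p : ℕ} (d : Fin p → ℕ) (q : ℕ) :
    Set (Matrix (Fin p) (Fin q) F[X]) :=
  {M | ∀ i, vecDegree (M i) ≤ d i}

/-- The polynomial matrices of degree at most `d`. -/
def matDegreeLE (F : Type*) [Field F] (p q d : ℕ) : Set (Matrix (Fin p) (Fin q) F[X]) :=
  {M | ∀ i j, (M i j).natDegree ≤ d}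

/-- Highest-row-degree coefficient matrix. -/
def highestRowDegreeCoeff {F : Type*} [Field F] {p q : ℕ} (P : Matrix (Fin p) (Fin q) F[X]) :
    Matrix (Fin p) (Fin q) F :=
  Matrix.of fun i j => (P i j).coeff (vecDegree (P i))

/-- The `k`-th Sylvester matrix of a `p × q` polynomial matrix of degree at most `d`. It has `k + d`
block rows and `k` block columns; the `p × q` block in block row `r` and block column `c` (numbered
from `0`) is the coefficient of `λ ^ (r - c)` if `c ≤ r`, and zero otherwise. -/
def sylvesterMat {F : Type*} [Field F] {p q : ℕ} (d k : ℕ) (M : Matrix (Fin p) (Fin q) F[X]) :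
    Matrix (Fin (k + d) × Fin p) (Fin k × Fin q) F :=
  Matrix.of fun r c =>
    if (c.1 : ℕ) ≤ (r.1 : ℕ) then (M r.2 c.2).coeff ((r.1 : ℕ) - (c.1 : ℕ)) else 0

/-- The maximum of the row degree bounds. -/
def maxBound {p : ℕ} (d : Fin p → ℕ) : ℕ := Finset.univ.sup d

theorem le_maxBound {p : ℕ} (d : Fin p → ℕ) (i : Fin p) : d i ≤ maxBound d :=
  Finset.le_sup (Finset.mem_univ i)

/-- The rows of the `k`-th Sylvester matrix that are kept when it is trimmed: for each `i`, the
`i`-th rows of the first `k + d i` block rows. -/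
def keptRow {p : ℕ} (d : Fin p → ℕ) (k : ℕ) (r : (i : Fin p) × Fin (k + d i)) :
    Fin (k + maxBound d) × Fin p :=
  (Fin.castLE (Nat.add_le_add_left (le_maxBound d r.1) k) r.2, r.1)

/-- The `k`-th trimmed Sylvester matrix of a polynomial matrix with row degrees at most `d`: for each
`i`, the last `maxBound d - d i` of the rows of the Sylvester matrix that come from the `i`-th row
of `M` are removed. -/
def trimmed {F : Type*} [Field F] {p q : ℕ} (d : Fin p → ℕ) (k : ℕ)
    (M : Matrix (Fin p) (Fin q) F[X]) :
    Matrix ((i : Fin p) × Fin (k + d i)) (Fin k × Fin q) F :=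
  (sylvesterMat (maxBound d) k M).submatrix (keptRow d k) id

/-- All the trimmed Sylvester matrices `T_k`, `k = 1, 2, …`, have full rank. -/
def FullTrimmedSylvesterRank {F : Type*} [Field F] {m n : ℕ} (d : Fin m → ℕ)
    (M : Matrix (Fin m) (Fin (m + n)) F[X]) : Prop :=
  ∀ k : ℕ, 1 ≤ k → (trimmed d k M).rank = min (k * m + ∑ i, d i) (k * (m + n))

/-- The spectral norm. -/
def norm2 {𝕜 : Type*} [RCLike 𝕜] {ι κ : Type*} [Fintype ι] [Fintype κ] [DecidableEq κ]
    (A : Matrix ι κ 𝕜) : ℝ :=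
  letI := Matrix.instL2OpNormedAddCommGroup (m := ι) (n := κ) (𝕜 := 𝕜)
  ‖A‖

/-- The Frobenius norm. -/
def normF {𝕜 : Type*} [RCLike 𝕜] {ι κ : Type*} [Fintype ι] [Fintype κ]
    (A : Matrix ι κ 𝕜) : ℝ :=
  letI := Matrix.frobeniusNormedAddCommGroup (m := ι) (n := κ) (α := 𝕜)
  ‖A‖

/-- `sigma j A` is the `j`-th largest singular value of `A`, numbered from `1`
(Mathlib numbers singular values from `0`). -/
def sigma {𝕜 : Type*} [RCLike 𝕜] {ι κ : Type*} [Fintype ι] [Fintype κ] [DecidableEq κ]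
    (j : ℕ) (A : Matrix ι κ 𝕜) : ℝ :=
  (Matrix.toEuclideanLin A).singularValues (j - 1)

/-- `k' = ⌈(∑ d_i) / n⌉`. -/
def kPrime {m : ℕ} (n : ℕ) (d : Fin m → ℕ) : ℕ := ⌈((∑ i, d i : ℕ) : ℚ) / (n : ℚ)⌉₊

/-- `t = n k' - ∑ d_i`; the subtraction is exact, see `n_mul_kPrime`. -/
def tPrime {m : ℕ} (n : ℕ) (d : Fin m → ℕ) : ℕ := n * kPrime n d - ∑ i, d i

theorem n_mul_kPrime {m n : ℕ} (hn : 0 < n) (d : Fin m → ℕ) :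
    n * kPrime n d = (∑ i, d i) + tPrime n d ∧ tPrime n d < n := by
  have hq : (0 : ℚ) < n := by exact_mod_cast hn
  have h1 : (∑ i, d i) ≤ n * kPrime n d := by
    have h := Nat.le_ceil (((∑ i, d i : ℕ) : ℚ) / (n : ℚ))
    rw [div_le_iff₀ hq] at h
    have h' : (∑ i, d i) ≤ kPrime n d * n := by exact_mod_cast h
    rwa [Nat.mul_comm] at h'
  have h2 : n * kPrime n d < (∑ i, d i) + n := by
    have h := Nat.ceil_lt_add_one (a := ((∑ i, d i : ℕ) : ℚ) / (n : ℚ)) (by positivity)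
    have h3 : (kPrime n d : ℚ) * n < (((∑ i, d i : ℕ) : ℚ) / (n : ℚ) + 1) * n :=
      mul_lt_mul_of_pos_right h hq
    rw [add_mul, div_mul_cancel₀ _ hq.ne', one_mul] at h3
    have h' : kPrime n d * n < (∑ i, d i) + n := by exact_mod_cast h3
    rwa [Nat.mul_comm] at h'
  unfold tPrime
  omega

/-- `θ₁(M)`. -/
def theta1 {𝕜 : Type*} [RCLike 𝕜] {m n : ℕ} (d : Fin m → ℕ)
    (M : Matrix (Fin m) (Fin (m + n)) 𝕜[X]) : ℝ :=
  let k := kPrime n d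
  let D := ∑ i, d i
  if tPrime n d = 0 then
    min (sigma (k * m + D) (trimmed d k M) / √(k : ℝ))
      (sigma (k * m + m + D) (trimmed d (k + 1) M) / √((k : ℝ) + 1))
  else if k = 1 then
    min (sigma (m + D) (trimmed d 1 M)) (sigma (2 * m + D) (trimmed d 2 M) / √2)
  else
    min (sigma ((k - 1) * (m + n)) (trimmed d (k - 1) M) / √((k : ℝ) - 1))
      (min (sigma (k * m + D) (trimmed d k M) / √(k : ℝ))
        (sigma (k * m + m + D) (trimmed d (k + 1) M) / √((k : ℝ) + 1)))

/-- `θ₂(M)`. -/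
def theta2 {𝕜 : Type*} [RCLike 𝕜] {m n : ℕ} (d : Fin m → ℕ)
    (M : Matrix (Fin m) (Fin (m + n)) 𝕜[X]) : ℝ :=
  let k := kPrime n d
  let D := ∑ i, d i
  if tPrime n d = 0 then
    sigma (k * m + m + D) (trimmed d (k + 1) M) / √((k : ℝ) + 1)
  else if k = 1 then
    min (sigma (m + D) (trimmed d 1 M)) (sigma (2 * m + D) (trimmed d 2 M) / √2)
  else
    min (sigma (k * m + D) (trimmed d k M) / √(k : ℝ))
      (sigma (k * m + m + D) (trimmed d (k + 1) M) / √((k : ℝ) + 1))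

end TrimmedSylvester

end

open Polynomial TrimmedSylvester

open Polynomial TrimmedSylvester

/-! In monomial coordinates `T_k(M)` is the map `v ↦ M v` from vectors of degree below `k` to
vectors whose `i`-th entry has degree below `k + d i`. Full rank therefore means that this map is
onto (`SurjAt`) or injective (`InjAt`). Surjectivity passes to larger `k`, injectivity to smaller
`k`, and `km + D ≤ k(m + n)` holds exactly when `k ≥ k'`, so only the indices `k'` and `k' - 1` have
to be checked (`fullTrimmedSylvesterRank_iff`).

Surjectivity also controls minimality. It makes `M` a minimal basis, and a dimension count in `ker
T_K(M)` shows that `n` independent null vectors have degree sum at least `D`. Conversely the given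
`N` has degree sum at most `D`, by an exchange argument. A dual minimal basis of the perturbed
matrix `M'` is thus any `n` independent null vectors whose degrees do not exceed those of `N`.

The perturbation enters through `‖T_k(M - M')‖ ≤ √k ‖T_1(M - M')‖`, the source of the square roots
in `θ₁` and `θ₂`. Below the smallest singular value, surjectivity and injectivity survive, and
`exists_null_vector_near` moves a null vector of `M` to one of `M'` with the same degree bound and
relative error `2ε/θ₂`, where `ε = ‖T_1(M - M')‖`. This is done row by row with `k = ε_j + 1`, which
is `k'` or `k' + 1`. The new rows are independent because their coefficients in the degrees `ε_j`
differ from `N_hr` by less than `σ_n(N_hr)`. -/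

namespace TrimmedSylvester

/-! ### Trimmed Sylvester matrices as multiplication maps on polynomial vectors of bounded degree.
-/

section Algebra

open Module

variable {F : Type*} [Field F] {m n p q : ℕ}

theorem vecDegree_le_iff {v : Fin q → F[X]} {e : ℕ} :
    vecDegree v ≤ e ↔ ∀ j, (v j).natDegree ≤ e := by
  simp [vecDegree]

theorem natDegree_le_iff_mem_degreeLT {f : F[X]} {e : ℕ} :
    f.natDegree ≤ e ↔ f ∈ degreeLT F (e + 1) := by
  rw [mem_degreeLT, degree_lt_iff_coeff_zero, natDegree_le_iff_coeff_eq_zero]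
  rfl

theorem vecDegree_le_iff_mem {v : Fin q → F[X]} {e : ℕ} :
    vecDegree v ≤ e ↔ ∀ j, v j ∈ degreeLT F (e + 1) := by
  simp only [vecDegree_le_iff, natDegree_le_iff_mem_degreeLT]

theorem mem_degreeLT_iff_coeff {f : F[X]} {k : ℕ} :
    f ∈ degreeLT F k ↔ ∀ r, k ≤ r → f.coeff r = 0 := by
  rw [mem_degreeLT, degree_lt_iff_coeff_zero]

/-- The polynomial vector with given coefficients. -/
noncomputable def ofCoeffs {k : ℕ} (x : Fin k × Fin q → F) : Fin q → F[X] :=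
  fun j => ∑ c : Fin k, monomial (c : ℕ) (x (c, j))

/-- The first `k` coefficients of a polynomial vector. -/
def coeffs (k : ℕ) (v : Fin q → F[X]) : Fin k × Fin q → F := fun c => (v c.2).coeff c.1

theorem ofCoeffs_coeff {k : ℕ} (x : Fin k × Fin q → F) (j : Fin q) (r : ℕ) :
    (ofCoeffs x j).coeff r = if h : r < k then x (⟨r, h⟩, j) else 0 := by
  simp only [ofCoeffs, finsetSum_coeff, coeff_monomial]
  split_ifs with h
  · rw [Finset.sum_eq_single ⟨r, h⟩]
    · simp
    · intro b _ hb
      rw [if_neg]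
      rintro rfl
      exact hb rfl
    · simp
  · refine Finset.sum_eq_zero fun c _ => if_neg ?_
    have := c.2
    omega

theorem ofCoeffs_mem {k : ℕ} (x : Fin k × Fin q → F) (j : Fin q) :
    ofCoeffs x j ∈ degreeLT F k := by
  rw [mem_degreeLT_iff_coeff]
  intro r hr
  rw [ofCoeffs_coeff, dif_neg (by omega)]

@[simp] theorem coeffs_ofCoeffs {k : ℕ} (x : Fin k × Fin q → F) : coeffs k (ofCoeffs x) = x := by
  ext ⟨c, j⟩
  simp [coeffs, ofCoeffs_coeff]

theorem ofCoeffs_coeffs {k : ℕ} {v : Fin q → F[X]} (hv : ∀ j, v j ∈ degreeLT F k) :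
    ofCoeffs (coeffs k v) = v := by
  ext j r
  rw [ofCoeffs_coeff]
  split_ifs with h
  · rfl
  · exact (mem_degreeLT_iff_coeff.1 (hv j) r (by omega)).symm

theorem trimmed_apply (d : Fin p → ℕ) (k : ℕ) (M : Matrix (Fin p) (Fin q) F[X])
    (r : (i : Fin p) × Fin (k + d i)) (c : Fin k × Fin q) :
    trimmed d k M r c =
      if (c.1 : ℕ) ≤ (r.2 : ℕ) then (M r.1 c.2).coeff ((r.2 : ℕ) - (c.1 : ℕ)) else 0 := by
  simp [trimmed, sylvesterMat, keptRow]

theorem trimmed_mulVec_apply (d : Fin p → ℕ) (k : ℕ) (M : Matrix (Fin p) (Fin q) F[X])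
    (x : Fin k × Fin q → F) (r : (i : Fin p) × Fin (k + d i)) :
    (trimmed d k M).mulVec x r = ((M.mulVec (ofCoeffs x)) r.1).coeff r.2 := by
  simp only [Matrix.mulVec, dotProduct, trimmed_apply, Fintype.sum_prod_type, finsetSum_coeff]
  rw [Finset.sum_comm]
  refine Finset.sum_congr rfl fun j _ => ?_
  simp only [ofCoeffs, Finset.mul_sum, finsetSum_coeff]
  refine Finset.sum_congr rfl fun c _ => ?_
  rw [← C_mul_X_pow_eq_monomial, ← mul_assoc, coeff_mul_X_pow', coeff_mul_C, ite_mul, zero_mul]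

theorem mulVec_mem_degreeLT {d : Fin p → ℕ} {M : Matrix (Fin p) (Fin q) F[X]}
    (hM : M ∈ rowDegreeLE F d q) {k : ℕ} {v : Fin q → F[X]} (hv : ∀ j, v j ∈ degreeLT F k)
    (i : Fin p) : M.mulVec v i ∈ degreeLT F (k + d i) := by
  rw [Matrix.mulVec_eq_sum, Finset.sum_apply]
  refine Submodule.sum_mem _ fun j _ => ?_
  rw [Pi.smul_apply, op_smul_eq_mul, Matrix.transpose_apply]
  have h1 := vecDegree_le_iff.1 (hM i) j
  have h2 := hv j
  rw [mem_degreeLT] at h2 ⊢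
  by_cases h0 : v j = 0
  · simp only [h0, mul_zero, degree_zero]
    exact WithBot.bot_lt_coe _
  by_cases h0' : M i j = 0
  · simp only [h0', zero_mul, degree_zero]
    exact WithBot.bot_lt_coe _
  rw [degree_eq_natDegree h0] at h2
  rw [degree_mul, degree_eq_natDegree h0, degree_eq_natDegree h0']
  norm_cast at h2 ⊢
  omega

/-- The kept rows carry the coefficients of `M v` in degrees below `k + d i`. The row degree bounds
make all others vanish, so trimming loses nothing. -/
theorem trimmed_mulVec_eq_iff {d : Fin p → ℕ} {M : Matrix (Fin p) (Fin q) F[X]}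
    (hM : M ∈ rowDegreeLE F d q) {k : ℕ} (x : Fin k × Fin q → F) {u : Fin p → F[X]}
    (hu : ∀ i, u i ∈ degreeLT F (k + d i)) :
    (trimmed d k M).mulVec x = (fun r => (u r.1).coeff r.2) ↔ M.mulVec (ofCoeffs x) = u := by
  constructor
  · intro h
    ext i r
    by_cases hr : r < k + d i
    · have := congrFun h ⟨i, ⟨r, hr⟩⟩
      rwa [trimmed_mulVec_apply] at this
    · rw [mem_degreeLT_iff_coeff.1 (hu i) r (by omega),
        mem_degreeLT_iff_coeff.1 (mulVec_mem_degreeLT hM (ofCoeffs_mem x) i) r (by omega)]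
  · rintro rfl
    ext r
    exact trimmed_mulVec_apply d k M x r

theorem trimmed_mulVec_eq_zero_iff {d : Fin p → ℕ} {M : Matrix (Fin p) (Fin q) F[X]}
    (hM : M ∈ rowDegreeLE F d q) {k : ℕ} (x : Fin k × Fin q → F) :
    (trimmed d k M).mulVec x = 0 ↔ M.mulVec (ofCoeffs x) = 0 := by
  rw [← trimmed_mulVec_eq_iff hM x (u := 0) fun i => Submodule.zero_mem _]
  simp [funext_iff]

/-- Every polynomial vector with `i`-th entry of degree less than `k + d i` is the image under `M`
of a polynomial vector of degree less than `k`. -/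
def SurjAt (d : Fin p → ℕ) (k : ℕ) (M : Matrix (Fin p) (Fin q) F[X]) : Prop :=
  ∀ u : Fin p → F[X], (∀ i, u i ∈ degreeLT F (k + d i)) →
    ∃ v : Fin q → F[X], (∀ j, v j ∈ degreeLT F k) ∧ M.mulVec v = u

/-- No nonzero polynomial vector of degree less than `k` is annihilated by `M`. -/
def InjAt (k : ℕ) (M : Matrix (Fin p) (Fin q) F[X]) : Prop :=
  ∀ v : Fin q → F[X], (∀ j, v j ∈ degreeLT F k) → M.mulVec v = 0 → v = 0

theorem surjAt_iff {d : Fin p → ℕ} {M : Matrix (Fin p) (Fin q) F[X]}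
    (hM : M ∈ rowDegreeLE F d q) {k : ℕ} :
    SurjAt d k M ↔ Function.Surjective (trimmed d k M).mulVec := by
  constructor
  · intro h y
    let u : Fin p → F[X] := fun i => ∑ r : Fin (k + d i), monomial (r : ℕ) (y ⟨i, r⟩)
    have hu : ∀ i, u i ∈ degreeLT F (k + d i) := fun i =>
      Submodule.sum_mem _ fun r _ => monomial_coe_mem_degreeLT r _
    obtain ⟨v, hv, hvu⟩ := h u hu
    refine ⟨coeffs k v, ?_⟩
    rw [← ofCoeffs_coeffs hv, ← trimmed_mulVec_eq_iff hM _ hu] at hvu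
    rw [hvu]
    ext ⟨i, r⟩
    simp only [u, finsetSum_coeff, coeff_monomial]
    rw [Finset.sum_eq_single r] <;> simp +contextual [Fin.val_inj]
  · intro h u hu
    obtain ⟨x, hx⟩ := h fun r => (u r.1).coeff r.2
    exact ⟨ofCoeffs x, ofCoeffs_mem x, (trimmed_mulVec_eq_iff hM x hu).1 hx⟩

theorem injAt_iff {d : Fin p → ℕ} {M : Matrix (Fin p) (Fin q) F[X]}
    (hM : M ∈ rowDegreeLE F d q) {k : ℕ} :
    InjAt k M ↔ ∀ x, (trimmed d k M).mulVec x = 0 → x = 0 := by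
  constructor
  · intro h x hx
    have := h (ofCoeffs x) (ofCoeffs_mem x) ((trimmed_mulVec_eq_zero_iff hM x).1 hx)
    rw [← coeffs_ofCoeffs x, this]
    rfl
  · intro h v hv hMv
    have := h (coeffs k v) ((trimmed_mulVec_eq_zero_iff hM _).2 (by rwa [ofCoeffs_coeffs hv]))
    rw [← ofCoeffs_coeffs hv, this]
    ext j r
    simp [ofCoeffs]

theorem InjAt.mono {k l : ℕ} {M : Matrix (Fin p) (Fin q) F[X]} (h : InjAt l M) (hkl : k ≤ l) :
    InjAt k M :=
  fun v hv => h v fun j => degreeLT_mono hkl (hv j)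

/-- Write `u = u(0) + X * u₁`. Both `u(0)` and `u₁` meet the degree bounds for `k` and lift to `v₀`
and `v₁`; then `v₀ + X v₁` lifts `u`. -/
theorem SurjAt.succ {d : Fin p → ℕ} {k : ℕ} {M : Matrix (Fin p) (Fin q) F[X]} (hk : 1 ≤ k)
    (h : SurjAt d k M) : SurjAt d (k + 1) M := by
  intro u hu
  obtain ⟨v₀, hv₀, h₀⟩ := h (fun i => C ((u i).coeff 0)) fun i => by
    rw [mem_degreeLT_iff_coeff]
    intro r hr
    rw [coeff_C, if_neg (by omega)]
  obtain ⟨v₁, hv₁, h₁⟩ := h (fun i => (u i).divX) fun i => by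
    rw [mem_degreeLT_iff_coeff]
    intro r hr
    rw [coeff_divX]
    exact mem_degreeLT_iff_coeff.1 (hu i) _ (by omega)
  refine ⟨v₀ + (X : F[X]) • v₁, fun j => ?_, ?_⟩
  · rw [Pi.add_apply, Pi.smul_apply, smul_eq_mul]
    refine Submodule.add_mem _ (degreeLT_mono (Nat.le_succ k) (hv₀ j)) ?_
    rw [mem_degreeLT_iff_coeff]
    rintro (_ | r) hr
    · omega
    · rw [coeff_X_mul]
      exact mem_degreeLT_iff_coeff.1 (hv₁ j) r (by omega)
  · rw [Matrix.mulVec_add, Matrix.mulVec_smul, h₀, h₁]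
    ext1 i
    simp only [Pi.add_apply, Pi.smul_apply, smul_eq_mul]
    rw [add_comm, X_mul, divX_mul_X_add]

theorem SurjAt.mono {d : Fin p → ℕ} {k l : ℕ} {M : Matrix (Fin p) (Fin q) F[X]} (hk : 1 ≤ k)
    (h : SurjAt d k M) (hkl : k ≤ l) : SurjAt d l M := by
  induction l, hkl using Nat.le_induction with
  | base => exact h
  | succ l hl ih => exact ih.succ (hk.trans hl)

theorem rank_eq_card_rows_iff {ι κ : Type*} [Fintype ι] [Fintype κ] (A : Matrix ι κ F) :
    A.rank = Fintype.card ι ↔ Function.Surjective A.mulVec := by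
  classical
  rw [Matrix.rank, ← Module.finrank_fintype_fun_eq_card F, ← Matrix.coe_mulVecLin,
    ← LinearMap.range_eq_top]
  exact ⟨fun h => Submodule.eq_top_of_finrank_eq h, fun h => by rw [h, finrank_top]⟩

theorem finrank_ker_add_rank {ι κ : Type*} [Fintype ι] [Fintype κ] (A : Matrix ι κ F) :
    finrank F (LinearMap.ker A.mulVecLin) + A.rank = Fintype.card κ := by
  rw [Matrix.rank, add_comm, LinearMap.finrank_range_add_finrank_ker,
    Module.finrank_fintype_fun_eq_card]

theorem rank_eq_card_cols_iff {ι κ : Type*} [Fintype ι] [Fintype κ] (A : Matrix ι κ F) :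
    A.rank = Fintype.card κ ↔ ∀ x, A.mulVec x = 0 → x = 0 := by
  have h := finrank_ker_add_rank A
  rw [← Matrix.ker_mulVecLin_eq_bot_iff, ← Submodule.finrank_eq_zero (R := F)]
  omega

theorem card_trimmed_rows (d : Fin p → ℕ) (k : ℕ) :
    Fintype.card ((i : Fin p) × Fin (k + d i)) = k * p + ∑ i, d i := by
  simp [Finset.sum_add_distrib, mul_comm]

theorem rank_eq_iff_surjAt {d : Fin p → ℕ} {M : Matrix (Fin p) (Fin q) F[X]}
    (hM : M ∈ rowDegreeLE F d q) {k : ℕ} :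
    (trimmed d k M).rank = k * p + ∑ i, d i ↔ SurjAt d k M := by
  rw [surjAt_iff hM, ← rank_eq_card_rows_iff, card_trimmed_rows]

theorem rank_eq_iff_injAt {d : Fin p → ℕ} {M : Matrix (Fin p) (Fin q) F[X]}
    (hM : M ∈ rowDegreeLE F d q) {k : ℕ} :
    (trimmed d k M).rank = k * q ↔ InjAt k M := by
  rw [injAt_iff hM, ← rank_eq_card_cols_iff]
  simp

/-- A polynomial matrix whose trimmed Sylvester matrices have full rank at the two indices around
`D / n` has full trimmed Sylvester rank. -/
theorem fullTrimmedSylvesterRank_iff (hn : 0 < n) {d : Fin m → ℕ} (hd : ∃ i, 0 < d i)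
    {M : Matrix (Fin m) (Fin (m + n)) F[X]} (hM : M ∈ rowDegreeLE F d (m + n)) :
    FullTrimmedSylvesterRank d M ↔
      SurjAt d (kPrime n d) M ∧ InjAt (kPrime n d - 1) M ∧
        (tPrime n d = 0 → InjAt (kPrime n d) M) := by
  obtain ⟨h1, h2⟩ := n_mul_kPrime hn d
  have hD : 0 < ∑ i, d i := by
    obtain ⟨i, hi⟩ := hd
    exact Finset.sum_pos' (fun _ _ => Nat.zero_le _) ⟨i, Finset.mem_univ _, hi⟩
  set D := ∑ i, d i with hDdef
  set k' := kPrime n d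
  set t := tPrime n d
  have hk' : 1 ≤ k' := by
    by_contra h
    have : k' = 0 := by omega
    rw [this] at h1
    omega
  have hge : ∀ k, k' ≤ k → k * m + D ≤ k * (m + n) := fun k hk => by
    have : n * k' ≤ n * k := Nat.mul_le_mul_left n hk
    rw [mul_add, mul_comm k n]
    omega
  have hlt : ∀ k, k < k' → k * (m + n) ≤ k * m + D := fun k hk => by
    have : n * (k + 1) ≤ n * k' := Nat.mul_le_mul_left n hk
    rw [mul_add n] at this
    rw [mul_add, mul_comm k n]
    omega
  constructor
  · intro h
    refine ⟨?_, ?_, fun ht => ?_⟩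
    · rw [← rank_eq_iff_surjAt hM, h k' hk', min_eq_left (hge k' le_rfl)]
    -- For `k' = 1` the rank hypothesis is silent at index `0`, but a vector of degree below `0` is
    -- zero.
    · rcases Nat.eq_zero_or_pos (k' - 1) with h0 | h0
      · intro v hv _
        ext j r
        exact mem_degreeLT_iff_coeff.1 (hv j) r (by omega)
      · rw [← rank_eq_iff_injAt hM, h _ h0, min_eq_right (hlt _ (by omega))]
    · rw [← rank_eq_iff_injAt hM, h _ hk', min_eq_right]
      rw [mul_add, mul_comm k' n]
      omega
  · rintro ⟨hs, hi, _⟩ k hk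
    rcases lt_or_ge k k' with hkk | hkk
    · rw [min_eq_right (hlt k hkk), rank_eq_iff_injAt hM]
      exact hi.mono (by omega)
    · rw [min_eq_left (hge k hkk), rank_eq_iff_surjAt hM]
      exact hs.mono hk' hkk

end Algebra

/-! ### Rational null spaces, degree sums and minimal bases. -/

section Rational

open Module

variable {F : Type*} [Field F] {m n p q : ℕ}

theorem toRatVec_sum_smul {ι : Type*} [Fintype ι] (c : ι → F[X]) (P : ι → Fin q → F[X]) :
    toRatVec (∑ i, c i • P i) = ∑ i, c i • toRatVec (P i) := by
  ext j
  simp [toRatVec, Finset.sum_apply, Algebra.smul_def]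

theorem toRatVec_injective : Function.Injective (toRatVec : (Fin q → F[X]) → Fin q → RatFunc F) :=
  fun _ _ h => funext fun j => IsFractionRing.injective F[X] (RatFunc F) (congrFun h j)

theorem toRatVec_zero : toRatVec (0 : Fin q → F[X]) = 0 := by
  ext j
  simp [toRatVec]

theorem linearIndependent_toRatVec_iff {ι : Type*} [Fintype ι] {P : ι → Fin q → F[X]} :
    LinearIndependent (RatFunc F) (fun i => toRatVec (P i)) ↔
      ∀ c : ι → F[X], ∑ i, c i • P i = 0 → c = 0 := by
  rw [← LinearIndependent.iff_fractionRing (R := F[X]) (K := RatFunc F),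
    Fintype.linearIndependent_iff]
  refine forall_congr' fun c => ?_
  rw [← toRatVec_sum_smul, ← toRatVec_zero, toRatVec_injective.eq_iff, funext_iff (f := c)]
  rfl

/-- The predictable degree argument: in a relation `∑ c i • P i = 0`, the coefficient at the largest
value `K` of `deg (c i) + e i` is a nontrivial constant relation between the coefficient rows. The
`e i` need only bound the degrees. -/
theorem linearIndependent_of_leadingCoeffs {ι : Type*} [Fintype ι] {P : ι → Fin q → F[X]}
    {e : ι → ℕ} (hP : ∀ i j, P i j ∈ degreeLT F (e i + 1))
    (h : LinearIndependent F fun i => fun j => (P i j).coeff (e i)) :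
    LinearIndependent (RatFunc F) fun i => toRatVec (P i) := by
  classical
  rw [linearIndependent_toRatVec_iff]
  intro c hc
  by_contra hne
  obtain ⟨i₀, hi₀⟩ := Function.ne_iff.1 hne
  obtain ⟨i₁, hi₁, hmax⟩ := Finset.exists_max_image (Finset.univ.filter fun i => c i ≠ 0)
    (fun i => (c i).natDegree + e i) ⟨i₀, by simpa using hi₀⟩
  simp only [Finset.mem_filter, Finset.mem_univ, true_and] at hi₁ hmax
  set K := (c i₁).natDegree + e i₁ with hK
  let a : ι → F := fun i => if e i ≤ K then (c i).coeff (K - e i) else 0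
  have ha : ∑ i, a i • (fun j => (P i j).coeff (e i)) = 0 := by
    ext j
    have h0 : (∑ i, c i * P i j).coeff K = 0 := by
      have := congrFun hc j
      simp only [Finset.sum_apply, Pi.smul_apply, smul_eq_mul, Pi.zero_apply] at this
      rw [this, coeff_zero]
    rw [finsetSum_coeff] at h0
    rw [Finset.sum_apply, Pi.zero_apply, ← h0]
    refine Finset.sum_congr rfl fun i _ => ?_
    rw [Pi.smul_apply, smul_eq_mul]
    have hdeg : (P i j).natDegree ≤ e i := natDegree_le_iff_mem_degreeLT.2 (hP i j)
    by_cases hci : c i = 0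
    · simp [a, hci]
    have hle := hmax i hci
    have : e i ≤ K := by omega
    simp only [a, if_pos this]
    have hs : K = (K - e i) + e i := by omega
    conv_rhs => rw [hs]
    rw [coeff_mul_add_eq_of_natDegree_le (by omega) hdeg]
  have := Fintype.linearIndependent_iff.1 h a ha i₁
  simp only [a, hK, if_pos (Nat.le_add_left _ _), Nat.add_sub_cancel] at this
  exact hi₁ (leadingCoeff_eq_zero.1 this)

/-- Annihilation depends only on the row space, so two bases of one row space have trimmed matrices
with the same kernel. -/
theorem mulVec_eq_zero_iff_forall {P : Matrix (Fin p) (Fin q) F[X]} {v : Fin q → F[X]} :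
    P.mulVec v = 0 ↔ ∀ w ∈ rowSpace P, ∑ j, w j * toRatVec v j = 0 := by
  have key : ∀ i, ∑ j, toRatVec (P i) j * toRatVec v j
      = algebraMap F[X] (RatFunc F) (P.mulVec v i) := fun i => by
    simp [Matrix.mulVec, dotProduct, toRatVec]
  constructor
  · intro h w hw
    induction hw using Submodule.span_induction with
    | mem w hw =>
      obtain ⟨i, rfl⟩ := hw
      rw [key, h, Pi.zero_apply, map_zero]
    | zero => simp
    | add x y _ _ hx hy => simp [add_mul, Finset.sum_add_distrib, hx, hy]
    | smul a x _ hx => simp [mul_assoc, ← Finset.mul_sum, hx]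
  · intro h
    ext1 i
    have := h _ (Submodule.subset_span ⟨i, rfl⟩)
    rw [key] at this
    exact (map_eq_zero_iff _ (IsFractionRing.injective F[X] (RatFunc F))).1 this

/-- The rational null space of a polynomial matrix. -/
noncomputable def nullSpace (M : Matrix (Fin p) (Fin q) F[X]) :
    Submodule (RatFunc F) (Fin q → RatFunc F) :=
  LinearMap.ker (M.map (algebraMap F[X] (RatFunc F))).mulVecLin

theorem toRatVec_mem_nullSpace {M : Matrix (Fin p) (Fin q) F[X]} {v : Fin q → F[X]} :
    toRatVec v ∈ nullSpace M ↔ M.mulVec v = 0 := by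
  rw [nullSpace, LinearMap.mem_ker, Matrix.mulVecLin_apply, funext_iff, funext_iff]
  refine forall_congr' fun i => ?_
  have : (M.map (algebraMap F[X] (RatFunc F))).mulVec (toRatVec v) i
      = algebraMap F[X] (RatFunc F) (M.mulVec v i) := by
    simp [Matrix.mulVec, dotProduct, toRatVec]
  rw [this, Pi.zero_apply, Pi.zero_apply,
    map_eq_zero_iff _ (IsFractionRing.injective F[X] (RatFunc F))]

theorem finrank_nullSpace {M : Matrix (Fin m) (Fin (m + n)) F[X]} (hM : RowsIndependent M) :
    finrank (RatFunc F) (nullSpace M) = n := by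
  have h := finrank_ker_add_rank (M.map (algebraMap F[X] (RatFunc F)))
  rw [LinearIndependent.rank_matrix (M := M.map (algebraMap F[X] (RatFunc F))) hM] at h
  simp only [Fintype.card_fin] at h
  rw [nullSpace]
  omega

theorem rowSpace_eq_nullSpace {M : Matrix (Fin m) (Fin (m + n)) F[X]} (hM : RowsIndependent M)
    {N : Matrix (Fin n) (Fin (m + n)) F[X]} (hN : RowsIndependent N)
    (hMN : ∀ j, M.mulVec (N j) = 0) : rowSpace N = nullSpace M := by
  apply Submodule.eq_of_le_of_finrank_eq
  · rw [rowSpace, Submodule.span_le]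
    rintro _ ⟨j, rfl⟩
    exact toRatVec_mem_nullSpace.2 (hMN j)
  · rw [finrank_nullSpace hM, rowSpace, finrank_span_eq_card hN, Fintype.card_fin]

theorem mul_transpose_eq_zero_iff {M : Matrix (Fin m) (Fin q) F[X]}
    {N : Matrix (Fin n) (Fin q) F[X]} :
    M * N.transpose = 0 ↔ ∀ j, M.mulVec (N j) = 0 := by
  constructor
  · intro h j
    ext1 i
    exact congrFun (congrFun h i) j
  · intro h
    ext1 i j
    exact congrFun (h j) i

/-- The unit vectors lie in the image of `M`; pairing a relation `c M = 0` with their preimages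
gives `c i = 0`. -/
theorem SurjAt.rowsIndependent {d : Fin p → ℕ} {k : ℕ} (hk : 1 ≤ k)
    {M : Matrix (Fin p) (Fin q) F[X]} (h : SurjAt d k M) : RowsIndependent M := by
  refine linearIndependent_toRatVec_iff.2 fun c hc => ?_
  ext1 i
  obtain ⟨v, -, hv⟩ := h (Pi.single i 1) fun l => by
    rw [mem_degreeLT_iff_coeff]
    intro r hr
    by_cases hl : l = i
    · subst hl
      rw [Pi.single_eq_same, coeff_one, if_neg (by omega)]
    · rw [Pi.single_eq_of_ne hl, coeff_zero]
  have h1 : Matrix.vecMul c M = 0 := by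
    rw [← hc, Matrix.vecMul_eq_sum]
  have h2 := Matrix.dotProduct_mulVec c M v
  rw [h1, hv, zero_dotProduct, dotProduct_single, mul_one] at h2
  exact h2

theorem finrank_ker_trimmed {d : Fin m → ℕ} {M : Matrix (Fin m) (Fin (m + n)) F[X]}
    (hM : M ∈ rowDegreeLE F d (m + n)) {k : ℕ} (h : SurjAt d k M) :
    finrank F (LinearMap.ker (trimmed d k M).mulVecLin) + ∑ i, d i = k * n := by
  have h1 := finrank_ker_add_rank (trimmed d k M)
  rw [(rank_eq_iff_surjAt hM).2 h] at h1
  simp only [Fintype.card_prod, Fintype.card_fin, mul_add] at h1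
  omega

/-- Independent polynomial vectors annihilated by `M` have degree sum at least `D`. -/
theorem sum_le_sum_vecDegree_of_mulVec_eq_zero {d : Fin m → ℕ}
    {M : Matrix (Fin m) (Fin (m + n)) F[X]} (hM : M ∈ rowDegreeLE F d (m + n)) {k : ℕ}
    (hk : 1 ≤ k) (h : SurjAt d k M) {Q : Matrix (Fin n) (Fin (m + n)) F[X]}
    (hQ : RowsIndependent Q) (hMQ : ∀ j, M.mulVec (Q j) = 0) :
    ∑ i, d i ≤ ∑ j, vecDegree (Q j) := by
  set e : Fin n → ℕ := fun j => vecDegree (Q j)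
  obtain ⟨K, hkK, heK⟩ : ∃ K, k ≤ K ∧ ∀ j, e j ≤ K :=
    ⟨k + ∑ j, e j, by omega, fun j =>
      (Finset.single_le_sum (fun _ _ => Nat.zero_le _) (Finset.mem_univ j)).trans
        (Nat.le_add_left _ _)⟩
  have hker := finrank_ker_trimmed hM (h.mono hk hkK)
  have hdeg : ∀ (s : (j : Fin n) × Fin (K - e j)) (l : Fin (m + n)),
      ((X : F[X]) ^ (s.2 : ℕ) • Q s.1) l ∈ degreeLT F K := by
    rintro ⟨j, s⟩ l
    have h1 : (Q j l).natDegree ≤ e j := vecDegree_le_iff.1 le_rfl l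
    have hs := s.2
    refine degreeLT_mono ?_ (natDegree_le_iff_mem_degreeLT.1 (natDegree_mul_le.trans
      (Nat.add_le_add_left h1 _)))
    rw [natDegree_X_pow]
    simp only at hs ⊢
    omega
  -- The shifts `X^s Q_j` with `s < K - e j` are `K n - ∑ e j` independent elements of `ker T_K(M)`,
  -- whose dimension is `K n - D`.
  let f : (j : Fin n) × Fin (K - e j) → LinearMap.ker (trimmed d K M).mulVecLin := fun s =>
    ⟨coeffs K ((X : F[X]) ^ (s.2 : ℕ) • Q s.1), by
      rw [LinearMap.mem_ker, Matrix.mulVecLin_apply, trimmed_mulVec_eq_zero_iff hM,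
        ofCoeffs_coeffs (hdeg s), Matrix.mulVec_smul, hMQ, smul_zero]⟩
  have hf : LinearIndependent F f := by
    rw [Fintype.linearIndependent_iff]
    intro c hc
    have hc1 : ∑ s, c s • coeffs K ((X : F[X]) ^ (s.2 : ℕ) • Q s.1) = 0 := by
      have := congrArg Subtype.val hc
      simpa [f] using this
    let g : Fin n → F[X] := fun j => ∑ s : Fin (K - e j), monomial (s : ℕ) (c ⟨j, s⟩)
    have hg : ∑ j, g j • Q j = 0 := by
      have hsum : ∑ j, g j • Q j = ∑ s : (j : Fin n) × Fin (K - e j),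
          c s • ((X : F[X]) ^ (s.2 : ℕ) • Q s.1) := by
        rw [Fintype.sum_sigma]
        refine Finset.sum_congr rfl fun j _ => ?_
        rw [Finset.sum_smul]
        refine Finset.sum_congr rfl fun s _ => ?_
        rw [← C_mul_X_pow_eq_monomial, mul_smul]
        ext l
        simp
      rw [hsum]
      ext l r
      rw [Finset.sum_apply, finsetSum_coeff]
      by_cases hr : r < K
      · have := congrFun hc1 (⟨r, hr⟩, l)
        simpa [coeffs] using this
      · refine Finset.sum_eq_zero fun s _ => ?_
        rw [Pi.smul_apply, coeff_smul, mem_degreeLT_iff_coeff.1 (hdeg s l) r (by omega), smul_zero]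
    have hg0 := linearIndependent_toRatVec_iff.1 hQ g hg
    rintro ⟨j, s⟩
    have h1 : (g j).coeff s = 0 := by rw [hg0, Pi.zero_apply, coeff_zero]
    simp only [g, finsetSum_coeff, coeff_monomial] at h1
    rw [Finset.sum_eq_single s] at h1
    · simpa using h1
    · intro b _ hb
      rw [if_neg (by rwa [Fin.val_inj])]
    · simp
  have hcard := hf.fintype_card_le_finrank
  simp only [Fintype.card_sigma, Fintype.card_fin] at hcard
  have hsum : ∑ j, (K - e j) + ∑ j, e j = K * n := by
    rw [← Finset.sum_add_distrib, Finset.sum_congr rfl fun j _ => Nat.sub_add_cancel (heK j)]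
    simp [mul_comm]
  change ∑ i, d i ≤ ∑ j, e j
  omega

theorem isMinimalBasis_of_mulVec_eq_zero {d : Fin m → ℕ}
    {M : Matrix (Fin m) (Fin (m + n)) F[X]} (hM : M ∈ rowDegreeLE F d (m + n)) {k : ℕ}
    (hk : 1 ≤ k) (h : SurjAt d k M) {N : Matrix (Fin n) (Fin (m + n)) F[X]}
    (hN : RowsIndependent N) (hMN : ∀ j, M.mulVec (N j) = 0)
    (hdeg : ∑ j, vecDegree (N j) ≤ ∑ i, d i) : IsMinimalBasis N := by
  refine ⟨hN, fun Q hQ hQN => hdeg.trans ?_⟩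
  refine sum_le_sum_vecDegree_of_mulVec_eq_zero hM hk h hQ fun j => ?_
  rw [← toRatVec_mem_nullSpace,
    ← rowSpace_eq_nullSpace (h.rowsIndependent hk) hN hMN, ← hQN]
  exact Submodule.subset_span ⟨j, rfl⟩

/-- For another basis `Q` of the row space, `T_k(Q)` has the kernel and hence the rank `kp + D` of
`T_k(M)`, while it has only `kp + ∑ deg Q_i` rows. -/
theorem SurjAt.isMinimalBasis {d : Fin p → ℕ} {M : Matrix (Fin p) (Fin q) F[X]}
    (hM : M ∈ rowDegreeLE F d q) {k : ℕ} (hk : 1 ≤ k) (h : SurjAt d k M) : IsMinimalBasis M := by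
  refine ⟨h.rowsIndependent hk, fun Q _ hQM => (Finset.sum_le_sum fun i _ => hM i).trans ?_⟩
  have hQ : Q ∈ rowDegreeLE F (fun i => vecDegree (Q i)) q := fun i => le_rfl
  have hker : LinearMap.ker (trimmed (fun i => vecDegree (Q i)) k Q).mulVecLin
      = LinearMap.ker (trimmed d k M).mulVecLin := by
    ext x
    rw [LinearMap.mem_ker, LinearMap.mem_ker, Matrix.mulVecLin_apply, Matrix.mulVecLin_apply,
      trimmed_mulVec_eq_zero_iff hQ, trimmed_mulVec_eq_zero_iff hM, mulVec_eq_zero_iff_forall,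
      mulVec_eq_zero_iff_forall, hQM]
  have h1 := finrank_ker_add_rank (trimmed d k M)
  have h2 := finrank_ker_add_rank (trimmed (fun i => vecDegree (Q i)) k Q)
  rw [hker] at h2
  rw [(rank_eq_iff_surjAt hM).2 h] at h1
  have h3 := (trimmed (fun i => vecDegree (Q i)) k Q).rank_le_card_height
  rw [card_trimmed_rows] at h3
  omega

/-- Steinitz exchange: the new rows still span the old row space, of dimension `n`. -/
theorem RowsIndependent.updateRow {N : Matrix (Fin n) (Fin q) F[X]} (hN : RowsIndependent N)
    {c : Fin n → RatFunc F} {w : Fin q → F[X]} (hw : ∑ i, c i • toRatVec (N i) = toRatVec w)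
    {j : Fin n} (hj : c j ≠ 0) : RowsIndependent (N.updateRow j w) := by
  have hfin : finrank (RatFunc F) (rowSpace N) = n := by
    rw [rowSpace, finrank_span_eq_card hN, Fintype.card_fin]
  have hle : rowSpace N ≤ rowSpace (N.updateRow j w) := by
    rw [rowSpace, Submodule.span_le]
    have hne : ∀ i, i ≠ j → toRatVec (N i) ∈ rowSpace (N.updateRow j w) := fun i hi =>
      Submodule.subset_span ⟨i, by simp only [Matrix.updateRow_ne hi]⟩
    rintro _ ⟨i, rfl⟩
    by_cases hi : i = j
    · subst hi
      have h1 : toRatVec (N i) = (c i)⁻¹ • (toRatVec w - ∑ l ∈ Finset.univ.erase i,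
          c l • toRatVec (N l)) := by
        rw [← hw, ← Finset.add_sum_erase _ _ (Finset.mem_univ i), add_sub_cancel_right,
          inv_smul_smul₀ hj]
      simp only [SetLike.mem_coe]
      rw [h1]
      refine Submodule.smul_mem _ _ (Submodule.sub_mem _ (Submodule.subset_span ⟨i, by simp only [Matrix.updateRow_self]⟩)
        (Submodule.sum_mem _ fun l hl => Submodule.smul_mem _ _ (hne l ?_)))
      exact Finset.ne_of_mem_erase hl
    · exact hne i hi
  refine linearIndependent_iff_card_le_finrank_span.2 ?_
  rw [Fintype.card_fin]
  exact hfin.symm.le.trans (Submodule.finrank_mono hle)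

/-- A minimal basis of degree at most `k` of the null space of `M` has degree sum at most `D`, as
soon as `M` has no null vectors of degree less than `k - 1` and `T_k(M)` is onto. -/
theorem IsMinimalBasis.sum_vecDegree_le {d : Fin m → ℕ} {M : Matrix (Fin m) (Fin (m + n)) F[X]}
    (hM : M ∈ rowDegreeLE F d (m + n)) {k : ℕ} (hk : 1 ≤ k) (hs : SurjAt d k M)
    (hi : InjAt (k - 1) M) {N : Matrix (Fin n) (Fin (m + n)) F[X]} (hN : IsMinimalBasis N)
    (hMN : ∀ j, M.mulVec (N j) = 0) (hNk : ∀ j, vecDegree (N j) ≤ k) :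
    ∑ j, vecDegree (N j) ≤ ∑ i, d i := by
  classical
  by_contra! hlt
  have hrow := rowSpace_eq_nullSpace (hs.rowsIndependent hk) hN.1 hMN
  set W := LinearMap.ker (trimmed d k M).mulVecLin with hW
  have hdim : finrank F W + ∑ i, d i = k * n := finrank_ker_trimmed hM hs
  let b := finBasis F W
  let w : Fin (finrank F W) → Fin (m + n) → F[X] := fun l => ofCoeffs (b l).1
  have hMw : ∀ l, M.mulVec (w l) = 0 := fun l =>
    (trimmed_mulVec_eq_zero_iff hM _).1 (LinearMap.mem_ker.1 (b l).2)
  have hwdeg : ∀ l j, w l j ∈ degreeLT F (k - 1 + 1) := fun l j => by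
    rw [Nat.sub_add_cancel hk]
    exact ofCoeffs_mem _ j
  -- A combination of the `w l` whose coefficient of degree `k - 1` vanishes is a null vector of
  -- degree below `k - 1`, hence zero by `hi`.
  have hwind : LinearIndependent (RatFunc F) fun l => toRatVec (w l) := by
    refine linearIndependent_of_leadingCoeffs (e := fun _ => k - 1) hwdeg ?_
    rw [Fintype.linearIndependent_iff]
    intro c hc
    have h0 : ofCoeffs (∑ l, c l • b l : W).1 = 0 := by
      refine hi _ (fun j => ?_)
        ((trimmed_mulVec_eq_zero_iff hM _).1 (LinearMap.mem_ker.1 (∑ l, c l • b l : W).2))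
      rw [mem_degreeLT_iff_coeff]
      intro r hr
      rcases hr.eq_or_lt with rfl | hr
      · have := congrFun hc j
        simp only [Finset.sum_apply, Pi.smul_apply, smul_eq_mul, w, ofCoeffs_coeff] at this ⊢
        rw [dif_pos (by omega)]
        simpa [show k - 1 < k by omega] using this
      · rw [ofCoeffs_coeff, dif_neg (by omega)]
    have h1 : (∑ l, c l • b l : W) = 0 := by
      apply Subtype.ext
      rw [← coeffs_ofCoeffs (∑ l, c l • b l : W).1, h0]
      rfl
    exact Fintype.linearIndependent_iff.1 b.linearIndependent c h1
  -- If the degree sum exceeds `D`, fewer than `dim W = k n - D` rows of `N` have degree below `k`.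
  -- Some `w l` then lies outside their span and can replace a row of degree `k`, which lowers the
  -- degree sum.
  let J : Finset (Fin n) := Finset.univ.filter fun j => vecDegree (N j) < k
  have hJ : J.card < finrank F W := by
    have h1 : ∑ j, vecDegree (N j) + J.card ≤ k * n := by
      rw [Finset.card_filter, ← Finset.sum_add_distrib]
      calc _ ≤ ∑ _j : Fin n, k := Finset.sum_le_sum fun j _ => by
            have := hNk j
            split_ifs <;> omega
        _ = k * n := by simp [mul_comm]
    omega
  obtain ⟨l, hl⟩ : ∃ l, toRatVec (w l) ∉
      Submodule.span (RatFunc F) ((J.image fun j => toRatVec (N j) : Finset _) : Set _) := by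
    by_contra! hall
    have h1 : finrank (RatFunc F) (Submodule.span (RatFunc F)
        (Set.range fun l => toRatVec (w l))) = finrank F W := by
      rw [finrank_span_eq_card hwind, Fintype.card_fin]
    have h2 := Submodule.finrank_mono (Submodule.span_le.2 (Set.range_subset_iff.2 hall))
    have h3 := finrank_span_finset_le_card (R := RatFunc F) (J.image fun j => toRatVec (N j))
    have h4 := Finset.card_image_le (s := J) (f := fun j => toRatVec (N j))
    rw [Set.finrank] at h3
    omega
  have hmem : toRatVec (w l) ∈ rowSpace N := by
    rw [hrow]
    exact toRatVec_mem_nullSpace.2 (hMw l)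
  obtain ⟨c, hc⟩ := (Submodule.mem_span_range_iff_exists_fun _).1 hmem
  obtain ⟨j, hjJ, hj⟩ : ∃ j, j ∉ J ∧ c j ≠ 0 := by
    by_contra! hall
    apply hl
    rw [← hc]
    refine Submodule.sum_mem _ fun j _ => ?_
    by_cases hj : j ∈ J
    · exact Submodule.smul_mem _ _ (Submodule.subset_span
        (Finset.mem_coe.2 (Finset.mem_image_of_mem (fun j => toRatVec (N j)) hj)))
    · rw [hall j hj, zero_smul]
      exact Submodule.zero_mem _
  have hind := hN.1.updateRow hc hj
  have hupd : ∀ i, M.mulVec (N.updateRow j (w l) i) = 0 := fun i => by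
    by_cases hij : i = j
    · subst hij
      rw [Matrix.updateRow_self, hMw]
    · rw [Matrix.updateRow_ne hij, hMN]
  have hmin := hN.2 _ hind
    ((rowSpace_eq_nullSpace (hs.rowsIndependent hk) hind hupd).trans hrow.symm)
  refine absurd hmin (not_le.2 (Finset.sum_lt_sum (fun i _ => ?_) ⟨j, Finset.mem_univ _, ?_⟩))
  · by_cases hij : i = j
    · subst hij
      have h1 : vecDegree (w l) ≤ k - 1 := vecDegree_le_iff_mem.2 (hwdeg l)
      have h2 : ¬ vecDegree (N i) < k := by simpa [J] using hjJ
      rw [Matrix.updateRow_self]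
      omega
    · rw [Matrix.updateRow_ne hij]
  · have h1 : vecDegree (w l) ≤ k - 1 := vecDegree_le_iff_mem.2 (hwdeg l)
    have h2 : ¬ vecDegree (N j) < k := by simpa [J] using hjJ
    rw [Matrix.updateRow_self]
    omega

theorem InjAt.le_vecDegree {k : ℕ} {M : Matrix (Fin p) (Fin q) F[X]} (h : InjAt k M)
    {v : Fin q → F[X]} (hv : v ≠ 0) (hMv : M.mulVec v = 0) : k ≤ vecDegree v := by
  by_contra! hlt
  refine hv (h v (fun j => ?_) hMv)
  exact degreeLT_mono hlt (vecDegree_le_iff_mem.1 le_rfl j)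

theorem RowsIndependent.row_ne_zero {P : Matrix (Fin p) (Fin q) F[X]} (h : RowsIndependent P)
    (i : Fin p) : P i ≠ 0 := by
  intro h0
  refine LinearIndependent.ne_zero i h ?_
  rw [h0, toRatVec_zero]

end Rational

/-! ### Singular value bounds and perturbation of trimmed Sylvester matrices. -/

section SingularValues

open Module

variable {𝕜 : Type*} [RCLike 𝕜]

section Abstract

variable {E G : Type*} [NormedAddCommGroup E] [InnerProductSpace 𝕜 E] [FiniteDimensional 𝕜 E]
  [NormedAddCommGroup G] [InnerProductSpace 𝕜 G] [FiniteDimensional 𝕜 G]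

theorem inner_map_eigenvectorBasis (T : E →ₗ[𝕜] G) {N : ℕ} (hN : finrank 𝕜 E = N) (i j : Fin N) :
    inner 𝕜 (T (T.isSymmetric_adjoint_comp_self.eigenvectorBasis hN i))
      (T (T.isSymmetric_adjoint_comp_self.eigenvectorBasis hN j))
      = if i = j then ((T.singularValues i : ℝ) : 𝕜) ^ 2 else 0 := by
  have h := T.isSymmetric_adjoint_comp_self.apply_eigenvectorBasis hN j
  rw [LinearMap.comp_apply] at h
  rw [← LinearMap.adjoint_inner_right, h, inner_smul_right,
    orthonormal_iff_ite.1 (T.isSymmetric_adjoint_comp_self.eigenvectorBasis hN).orthonormal]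
  split_ifs with hij
  · subst hij
    rw [mul_one, ← T.sq_singularValues_fin hN i, RCLike.ofReal_pow]
  · rw [mul_zero]

theorem singularValues_mul_norm_le (T : E →ₗ[𝕜] G) {N : ℕ} (hN : finrank 𝕜 E = N) (x : E) :
    T.singularValues (N - 1) * ‖x‖ ≤ ‖T x‖ := by
  set b := T.isSymmetric_adjoint_comp_self.eigenvectorBasis hN with hb
  refine le_of_sq_le_sq ?_ (norm_nonneg _)
  have h1 : ‖T x‖ ^ 2 = ∑ i : Fin N, (T.singularValues i) ^ 2 * ‖inner 𝕜 (b i) x‖ ^ 2 := by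
    have h2 : (inner 𝕜 (T x) (T x) : 𝕜)
        = ∑ i : Fin N, (((T.singularValues i) ^ 2 * ‖inner 𝕜 (b i) x‖ ^ 2 : ℝ) : 𝕜) := by
      have hx : T x = ∑ i, inner 𝕜 (b i) x • T (b i) := by
        conv_lhs => rw [← b.sum_repr' x, map_sum]
        simp only [map_smul]
      conv_lhs => rw [hx]
      simp only [sum_inner, inner_sum, inner_smul_left, inner_smul_right, hb,
        inner_map_eigenvectorBasis, mul_ite, mul_zero, Finset.sum_ite_eq', Finset.mem_univ,
        if_true]
      refine Finset.sum_congr rfl fun i _ => ?_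
      rw [← mul_assoc, RCLike.mul_conj]
      push_cast
      ring
    rw [@norm_sq_eq_re_inner 𝕜, h2, ← RCLike.ofReal_sum, RCLike.ofReal_re]
  rw [h1, mul_pow, ← b.sum_sq_norm_inner_right x, Finset.mul_sum]
  refine Finset.sum_le_sum fun i _ => mul_le_mul_of_nonneg_right ?_ (sq_nonneg _)
  exact pow_le_pow_left₀ (T.singularValues_nonneg _) (T.singularValues_antitone (by omega)) 2

/-- If the `P`-th singular value is positive, the normalized images of the first `P` right singular
vectors form an orthonormal basis of `G`. Bessel's inequality for `T* y` against those right
singular vectors gives the bound. -/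
theorem singularValues_mul_norm_le_adjoint (T : E →ₗ[𝕜] G) {P : ℕ} (hP : finrank 𝕜 G = P)
    (hle : P ≤ finrank 𝕜 E) (y : G) :
    T.singularValues (P - 1) * ‖y‖ ≤ ‖LinearMap.adjoint T y‖ := by
  set b := T.isSymmetric_adjoint_comp_self.eigenvectorBasis rfl with hb
  rcases (T.singularValues_nonneg (P - 1)).eq_or_lt with h0 | hpos
  · rw [← h0, zero_mul]
    exact norm_nonneg _
  have hσ : ∀ i : Fin P, T.singularValues (P - 1) ≤ T.singularValues i := fun i =>
    T.singularValues_antitone (by omega)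
  have hne : ∀ i : Fin P, ((T.singularValues i : ℝ) : 𝕜) ≠ 0 := fun i =>
    RCLike.ofReal_ne_zero.2 (hpos.trans_le (hσ i)).ne'
  let u : Fin P → G := fun i => ((T.singularValues i : ℝ) : 𝕜)⁻¹ • T (b (Fin.castLE hle i))
  have hu : Orthonormal 𝕜 u := by
    rw [orthonormal_iff_ite]
    intro i j
    simp only [u, inner_smul_left, inner_smul_right, hb, inner_map_eigenvectorBasis,
      (Fin.castLE_injective hle).eq_iff]
    split_ifs with hij
    · subst hij
      have := hne i
      simp only [map_inv₀, RCLike.conj_ofReal, Fin.val_castLE]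
      field_simp
    · simp
  let B : OrthonormalBasis (Fin P) 𝕜 G := OrthonormalBasis.mk hu (by
    rw [hu.linearIndependent.span_eq_top_of_card_eq_finrank' (by simp [hP])])
  have hBu : ∀ i, B i = u i := fun i => by simp [B]
  refine le_of_sq_le_sq ?_ (norm_nonneg _)
  rw [mul_pow, ← B.sum_sq_norm_inner_right y, Finset.mul_sum]
  have hbo : Orthonormal 𝕜 fun i : Fin P => b (Fin.castLE hle i) :=
    b.orthonormal.comp _ (Fin.castLE_injective hle)
  refine le_trans (Finset.sum_le_sum fun i _ => ?_)
    (hbo.sum_inner_products_le (s := Finset.univ) (LinearMap.adjoint T y))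
  have h1 : ‖(inner 𝕜 (b (Fin.castLE hle i)) (LinearMap.adjoint T y) : 𝕜)‖
      = T.singularValues i * ‖(inner 𝕜 (B i) y : 𝕜)‖ := by
    have : T (b (Fin.castLE hle i)) = ((T.singularValues i : ℝ) : 𝕜) • B i := by
      rw [hBu, smul_inv_smul₀ (hne i)]
    rw [LinearMap.adjoint_inner_right, this, inner_smul_left, norm_mul, RCLike.conj_ofReal,
      RCLike.norm_ofReal, abs_of_nonneg (T.singularValues_nonneg _)]
  rw [h1, mul_pow]
  exact mul_le_mul_of_nonneg_right (pow_le_pow_left₀ hpos.le (hσ i) 2) (sq_nonneg _)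

/-- A small perturbation of an onto map is onto, with a bound on the preimages. -/
theorem exists_preimage_of_perturbation (T T' : E →ₗ[𝕜] G) {P : ℕ} (hP : finrank 𝕜 G = P)
    (hle : P ≤ finrank 𝕜 E) {δ : ℝ} (hδ : ∀ x, ‖(T - T') x‖ ≤ δ * ‖x‖)
    (hlt : δ < T.singularValues (P - 1)) (y : G) :
    ∃ x, T' x = y ∧ (T.singularValues (P - 1) - δ) * ‖x‖ ≤ ‖y‖ := by
  set c := T.singularValues (P - 1) - δ
  have hc : 0 < c := sub_pos.2 hlt
  have hadj : ∀ z, ‖LinearMap.adjoint (T - T') z‖ ≤ δ * ‖z‖ := fun z => by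
    rcases (norm_nonneg (LinearMap.adjoint (T - T') z)).eq_or_lt with h0 | hpos
    · rw [← h0]
      -- The sign of `δ` is not assumed; `δ < 0` forces `E = 0`, hence `G = 0`.
      by_contra! hneg
      have hδ0 : δ < 0 := by
        by_contra! h
        exact absurd hneg (not_lt.2 (mul_nonneg h (norm_nonneg z)))
      have hE : ∀ x : E, x = 0 := fun x => by
        by_contra hx
        have := hδ x
        have h3 : δ * ‖x‖ < 0 := mul_neg_of_neg_of_pos hδ0 (norm_pos_iff.2 hx)
        linarith [norm_nonneg ((T - T') x)]
      have hEs : Subsingleton E := ⟨fun a b => by rw [hE a, hE b]⟩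
      have hE0 : finrank 𝕜 E = 0 := finrank_zero_of_subsingleton
      have hG : Subsingleton G := finrank_zero_iff.1 (show finrank 𝕜 G = 0 by omega)
      rw [Subsingleton.elim z 0, norm_zero, mul_zero] at hneg
      exact lt_irrefl _ hneg
    · set w := LinearMap.adjoint (T - T') z with hw
      have h1 : ‖w‖ * ‖w‖ ≤ (δ * ‖z‖) * ‖w‖ := by
        have h2 : ‖(inner 𝕜 w w : 𝕜)‖ = ‖w‖ * ‖w‖ := by
          rw [inner_self_eq_norm_sq_to_K, norm_pow, RCLike.norm_ofReal, abs_norm, sq]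
        rw [← h2]
        conv_lhs => rw [hw, LinearMap.adjoint_inner_left, ← hw]
        calc _ ≤ ‖z‖ * ‖(T - T') w‖ := norm_inner_le_norm _ _
          _ ≤ ‖z‖ * (δ * ‖w‖) := mul_le_mul_of_nonneg_left (hδ w) (norm_nonneg _)
          _ = _ := by ring
      exact le_of_mul_le_mul_right h1 hpos
  have hlow : ∀ z, c * ‖z‖ ≤ ‖LinearMap.adjoint T' z‖ := fun z => by
    have h1 := singularValues_mul_norm_le_adjoint T hP hle z
    have h2 : LinearMap.adjoint T z
        = LinearMap.adjoint (T - T') z + LinearMap.adjoint T' z := by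
      rw [map_sub, LinearMap.sub_apply, sub_add_cancel]
    have h3 := norm_add_le (LinearMap.adjoint (T - T') z) (LinearMap.adjoint T' z)
    rw [← h2] at h3
    have h4 := hadj z
    simp only [c, sub_mul]
    linarith
  -- As `T'*` is bounded below, `T' T'*` is bijective and `x = T'* (T' T'*)⁻¹ y` solves `T' x = y`.
  -- The bound follows from `‖x‖² = ⟨z, y⟩` and `c ‖z‖ ≤ ‖x‖`.
  have hinj : Function.Injective (T' ∘ₗ LinearMap.adjoint T') := by
    rw [injective_iff_map_eq_zero]
    intro z hz
    have h1 : (inner 𝕜 (LinearMap.adjoint T' z) (LinearMap.adjoint T' z) : 𝕜) = 0 := by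
      rw [LinearMap.adjoint_inner_left, ← LinearMap.comp_apply T', hz, inner_zero_right]
    rw [inner_self_eq_zero] at h1
    have h2 := hlow z
    rw [h1, norm_zero] at h2
    by_contra hz0
    have := mul_pos hc (norm_pos_iff.2 hz0)
    linarith
  obtain ⟨z, hz⟩ := (LinearMap.injective_iff_surjective.1 hinj) y
  refine ⟨LinearMap.adjoint T' z, hz, ?_⟩
  set x := LinearMap.adjoint T' z with hx
  rcases (norm_nonneg x).eq_or_lt with h0 | hpos
  · rw [← h0, mul_zero]
    exact norm_nonneg _
  have h1 : ‖x‖ * ‖x‖ ≤ ‖z‖ * ‖y‖ := by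
    have h2 : ‖(inner 𝕜 x x : 𝕜)‖ = ‖x‖ * ‖x‖ := by
      rw [inner_self_eq_norm_sq_to_K, norm_pow, RCLike.norm_ofReal, abs_norm, sq]
    rw [← h2]
    conv_lhs => rw [hx, LinearMap.adjoint_inner_left]
    rw [← LinearMap.comp_apply T', hz]
    exact norm_inner_le_norm _ _
  have h2 : c * ‖x‖ * ‖x‖ ≤ ‖y‖ * ‖x‖ := by
    have h3 := mul_le_mul_of_nonneg_left h1 hc.le
    have h4 := mul_le_mul_of_nonneg_right (hlow z) (norm_nonneg y)
    rw [← hx] at h4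
    nlinarith
  exact le_of_mul_le_mul_right h2 hpos

end Abstract

section MatrixNorms

variable {ι κ : Type*} [Fintype ι] [Fintype κ]

theorem norm_toEuclideanLin_le_norm2 [DecidableEq κ] (A : Matrix ι κ 𝕜) (x : EuclideanSpace 𝕜 κ) :
    ‖Matrix.toEuclideanLin A x‖ ≤ norm2 A * ‖x‖ :=
  Matrix.l2_opNorm_mulVec A x

theorem norm2_nonneg [DecidableEq κ] (A : Matrix ι κ 𝕜) : 0 ≤ norm2 A := by
  let := Matrix.instL2OpNormedAddCommGroup (m := ι) (n := κ) (𝕜 := 𝕜)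
  exact norm_nonneg A

theorem normF_nonneg (A : Matrix ι κ 𝕜) : 0 ≤ normF A := by
  let := Matrix.frobeniusNormedAddCommGroup (m := ι) (n := κ) (α := 𝕜)
  exact norm_nonneg A

theorem normF_sq (A : Matrix ι κ 𝕜) : normF A ^ 2 = ∑ i, ∑ j, ‖A i j‖ ^ 2 := by
  have h : normF A = (∑ i, ∑ j, ‖A i j‖ ^ (2 : ℝ)) ^ (1 / 2 : ℝ) := Matrix.frobenius_norm_def A
  rw [h, ← Real.sqrt_eq_rpow, Real.sq_sqrt (by positivity)]
  simp

theorem norm_toEuclideanLin_le_normF [DecidableEq κ] (A : Matrix ι κ 𝕜)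
    (x : EuclideanSpace 𝕜 κ) : ‖Matrix.toEuclideanLin A x‖ ≤ normF A * ‖x‖ := by
  refine le_of_sq_le_sq ?_ (mul_nonneg (normF_nonneg A) (norm_nonneg x))
  rw [mul_pow, normF_sq, EuclideanSpace.norm_sq_eq, Finset.sum_mul, EuclideanSpace.norm_sq_eq]
  refine Finset.sum_le_sum fun i _ => ?_
  have h1 : ‖(Matrix.toEuclideanLin A x) i‖ ≤ ∑ j, ‖A i j‖ * ‖x j‖ := by
    simp only [Matrix.toLpLin_apply, Matrix.mulVec, dotProduct]
    exact (norm_sum_le _ _).trans_eq (Finset.sum_congr rfl fun j _ => norm_mul _ _)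
  exact (pow_le_pow_left₀ (norm_nonneg _) h1 2).trans (Finset.sum_mul_sq_le_sq_mul_sq _ _ _)

theorem sigma_nonneg [DecidableEq κ] (j : ℕ) (A : Matrix ι κ 𝕜) : 0 ≤ sigma j A :=
  LinearMap.singularValues_nonneg _ _

/-- The rows of a matrix closer to `A` than its smallest singular value are independent. -/
theorem linearIndependent_rows_of_normF_sub_lt {p q : ℕ} (hpq : p ≤ q)
    (A B : Matrix (Fin p) (Fin q) 𝕜) (h : normF (A - B) < sigma p A) :
    LinearIndependent 𝕜 fun i => B i := by
  rw [Fintype.linearIndependent_iff]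
  intro c hc i
  obtain ⟨x, hx, -⟩ := exists_preimage_of_perturbation (Matrix.toEuclideanLin A)
    (Matrix.toEuclideanLin B) (P := p) (by simp) (by simpa using hpq) (δ := normF (A - B))
    (fun x => by
      rw [← map_sub]
      exact norm_toEuclideanLin_le_normF _ x) h (WithLp.toLp 2 (Pi.single i 1))
  have hx' : B.mulVec (WithLp.ofLp x) = Pi.single i 1 := congrArg WithLp.ofLp hx
  have h1 : Matrix.vecMul c B = 0 := by
    rw [← hc, Matrix.vecMul_eq_sum]
  have h2 := Matrix.dotProduct_mulVec c B (WithLp.ofLp x)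
  rw [h1, hx', zero_dotProduct, dotProduct_single, mul_one] at h2
  exact h2

theorem sigma_le_normF {p q : ℕ} (hp : 0 < p) (hpq : p ≤ q) (A : Matrix (Fin p) (Fin q) 𝕜) :
    sigma p A ≤ normF A := by
  by_contra! h
  refine (linearIndependent_rows_of_normF_sub_lt hpq A 0 (by rwa [sub_zero])).ne_zero ⟨0, hp⟩ rfl

end MatrixNorms

section Trimmed

variable {m n p q : ℕ}

theorem trimmed_sub (d : Fin p → ℕ) (k : ℕ) (M M' : Matrix (Fin p) (Fin q) 𝕜[X]) :
    trimmed d k (M - M') = trimmed d k M - trimmed d k M' := by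
  ext r c
  simp only [trimmed_apply, Matrix.sub_apply, coeff_sub]
  split_ifs <;> simp

theorem sub_mem_rowDegreeLE {d : Fin p → ℕ} {M M' : Matrix (Fin p) (Fin q) 𝕜[X]}
    (hM : M ∈ rowDegreeLE 𝕜 d q) (hM' : M' ∈ rowDegreeLE 𝕜 d q) :
    M - M' ∈ rowDegreeLE 𝕜 d q := fun i =>
  vecDegree_le_iff_mem.2 fun j =>
    Submodule.sub_mem _ (vecDegree_le_iff_mem.1 (hM i) j) (vecDegree_le_iff_mem.1 (hM' i) j)

theorem sum_range_shift_le {f : ℕ → ℝ} (hf : ∀ s, 0 ≤ f s) {L : ℕ} (hL : ∀ s, L ≤ s → f s = 0)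
    (K c : ℕ) :
    ∑ r ∈ Finset.range K, (if c ≤ r then f (r - c) else 0) ≤ ∑ s ∈ Finset.range L, f s := by
  calc ∑ r ∈ Finset.range K, (if c ≤ r then f (r - c) else 0)
      ≤ ∑ r ∈ Finset.range (c + K), (if c ≤ r then f (r - c) else 0) := by
        refine Finset.sum_le_sum_of_subset_of_nonneg (Finset.range_mono (by omega)) ?_
        intro r _ _
        split_ifs
        · exact hf _
        · exact le_rfl
    _ = ∑ s ∈ Finset.range K, f s := by
        rw [Finset.sum_range_add, Finset.sum_eq_zero, zero_add]
        · simp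
        · intro r hr
          rw [if_neg (by simpa using hr)]
    _ ≤ ∑ s ∈ Finset.range (max K L), f s :=
        Finset.sum_le_sum_of_subset_of_nonneg (Finset.range_mono (le_max_left _ _))
          fun s _ _ => hf s
    _ = ∑ s ∈ Finset.range L, f s :=
        (Finset.sum_subset (Finset.range_mono (le_max_right _ _)) fun s _ hs =>
          hL s (by simpa using hs)).symm

/-- Each block column of `T_k(M)` is a shifted copy of `T_1(M)`, so it has the same norm bound.
Summing over the `k` blocks of `x` by Cauchy–Schwarz costs the factor `√k`. -/
theorem norm_toEuclideanLin_trimmed_le {d : Fin p → ℕ} {M : Matrix (Fin p) (Fin q) 𝕜[X]}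
    (hM : M ∈ rowDegreeLE 𝕜 d q) (k : ℕ) (x : EuclideanSpace 𝕜 (Fin k × Fin q)) :
    ‖Matrix.toEuclideanLin (trimmed d k M) x‖ ≤ √(k : ℝ) * norm2 (trimmed d 1 M) * ‖x‖ := by
  let xc : Fin k → EuclideanSpace 𝕜 (Fin 1 × Fin q) := fun c =>
    WithLp.toLp 2 fun a => x (c, a.2)
  let w : Fin k → Fin p → 𝕜[X] := fun c => M.mulVec (ofCoeffs (WithLp.ofLp (xc c)))
  let z : Fin k → EuclideanSpace 𝕜 ((i : Fin p) × Fin (k + d i)) := fun c =>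
    WithLp.toLp 2 fun r => ((X : 𝕜[X]) ^ (c : ℕ) * w c r.1).coeff r.2
  have hsum : Matrix.toEuclideanLin (trimmed d k M) x = ∑ c, z c := by
    have hx : ofCoeffs (WithLp.ofLp x)
        = ∑ c : Fin k, (X : 𝕜[X]) ^ (c : ℕ) • ofCoeffs (WithLp.ofLp (xc c)) := by
      ext1 j
      rw [Finset.sum_apply]
      refine Finset.sum_congr rfl fun c _ => ?_
      simp [ofCoeffs, xc, X_pow_mul, C_mul_X_pow_eq_monomial]
    ext r
    have h1 : (Matrix.toEuclideanLin (trimmed d k M) x) r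
        = (M.mulVec (ofCoeffs (WithLp.ofLp x)) r.1).coeff r.2 := trimmed_mulVec_apply d k M _ r
    rw [h1, hx, Matrix.mulVec_sum, Finset.sum_apply, finsetSum_coeff, WithLp.ofLp_sum,
      Finset.sum_apply]
    simp only [Matrix.mulVec_smul, z, w, Pi.smul_apply, smul_eq_mul]
  have hz : ∀ c, ‖z c‖ ≤ norm2 (trimmed d 1 M) * ‖xc c‖ := fun c => by
    refine le_trans ?_ (norm_toEuclideanLin_le_norm2 (trimmed d 1 M) (xc c))
    refine le_of_sq_le_sq ?_ (norm_nonneg _)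
    rw [EuclideanSpace.norm_sq_eq, EuclideanSpace.norm_sq_eq, Fintype.sum_sigma,
      Fintype.sum_sigma]
    refine Finset.sum_le_sum fun i _ => ?_
    have h1 : ∀ r : Fin (1 + d i), (Matrix.toEuclideanLin (trimmed d 1 M) (xc c)) ⟨i, r⟩
        = (w c i).coeff r := fun r => trimmed_mulVec_apply d 1 M _ _
    simp only [h1, z, coeff_X_pow_mul']
    rw [Fin.sum_univ_eq_sum_range (fun r => ‖if (c : ℕ) ≤ r then (w c i).coeff (r - c) else 0‖ ^ 2),
      Fin.sum_univ_eq_sum_range (fun r => ‖(w c i).coeff r‖ ^ 2)]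
    refine le_trans (Finset.sum_le_sum fun r _ => ?_) (sum_range_shift_le
      (f := fun s => ‖(w c i).coeff s‖ ^ 2) (fun s => sq_nonneg _) (fun s hs => ?_) (k + d i) c)
    · split_ifs <;> simp
    · rw [mem_degreeLT_iff_coeff.1 (mulVec_mem_degreeLT hM (ofCoeffs_mem _) i) s hs]
      simp
  have hcs : ∑ c, ‖xc c‖ ≤ √(k : ℝ) * ‖x‖ := by
    refine le_of_sq_le_sq ?_ (by positivity)
    rw [mul_pow, Real.sq_sqrt (Nat.cast_nonneg k), EuclideanSpace.norm_sq_eq x,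
      Fintype.sum_prod_type]
    have h2 := sq_sum_le_card_mul_sum_sq (s := Finset.univ) (f := fun c => ‖xc c‖)
    rw [Finset.card_univ, Fintype.card_fin] at h2
    refine h2.trans_eq ?_
    congr 1
    refine Finset.sum_congr rfl fun c _ => ?_
    rw [EuclideanSpace.norm_sq_eq, Fintype.sum_prod_type]
    simp [xc]
  calc ‖Matrix.toEuclideanLin (trimmed d k M) x‖ ≤ ∑ c, ‖z c‖ := by
        rw [hsum]
        exact norm_sum_le _ _
    _ ≤ ∑ c, norm2 (trimmed d 1 M) * ‖xc c‖ := Finset.sum_le_sum fun c _ => hz c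
    _ = norm2 (trimmed d 1 M) * ∑ c, ‖xc c‖ := (Finset.mul_sum _ _ _).symm
    _ ≤ norm2 (trimmed d 1 M) * (√(k : ℝ) * ‖x‖) :=
        mul_le_mul_of_nonneg_left hcs (norm2_nonneg _)
    _ = _ := by ring

theorem norm_toEuclideanLin_trimmed_sub_le {d : Fin p → ℕ} {M M' : Matrix (Fin p) (Fin q) 𝕜[X]}
    (hM : M ∈ rowDegreeLE 𝕜 d q) (hM' : M' ∈ rowDegreeLE 𝕜 d q) (k : ℕ)
    (x : EuclideanSpace 𝕜 (Fin k × Fin q)) :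
    ‖(Matrix.toEuclideanLin (trimmed d k M) - Matrix.toEuclideanLin (trimmed d k M')) x‖
      ≤ √(k : ℝ) * norm2 (trimmed d 1 M - trimmed d 1 M') * ‖x‖ := by
  rw [← map_sub, ← trimmed_sub, ← trimmed_sub]
  exact norm_toEuclideanLin_trimmed_le (sub_mem_rowDegreeLE hM hM') k x

theorem injAt_of_norm2_sub_lt {d : Fin p → ℕ} {M M' : Matrix (Fin p) (Fin q) 𝕜[X]}
    (hM : M ∈ rowDegreeLE 𝕜 d q) (hM' : M' ∈ rowDegreeLE 𝕜 d q) {k : ℕ} (hk : 1 ≤ k)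
    (h : norm2 (trimmed d 1 M - trimmed d 1 M') < sigma (k * q) (trimmed d k M) / √(k : ℝ)) :
    InjAt k M' := by
  have hk0 : (0 : ℝ) < √(k : ℝ) := Real.sqrt_pos.2 (by exact_mod_cast hk)
  rw [injAt_iff hM']
  intro x hx
  rw [lt_div_iff₀ hk0] at h
  by_contra hne
  have hpos : 0 < ‖(WithLp.toLp 2 x : EuclideanSpace 𝕜 (Fin k × Fin q))‖ := by
    rw [norm_pos_iff]
    intro h0
    exact hne (congrArg WithLp.ofLp h0)
  have h1 := norm_toEuclideanLin_trimmed_sub_le hM hM' k (WithLp.toLp 2 x)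
  have h2 := singularValues_mul_norm_le (Matrix.toEuclideanLin (trimmed d k M)) (N := k * q)
    (by simp) (WithLp.toLp 2 x)
  have h3 : Matrix.toEuclideanLin (trimmed d k M') (WithLp.toLp 2 x) = 0 := by
    rw [Matrix.toLpLin_apply, hx]
    rfl
  rw [LinearMap.sub_apply, h3, sub_zero] at h1
  have h4 := le_of_mul_le_mul_right (h2.trans h1) hpos
  rw [sigma] at h
  linarith

theorem exists_preimage_trimmed {d : Fin p → ℕ} {M M' : Matrix (Fin p) (Fin q) 𝕜[X]}
    (hM : M ∈ rowDegreeLE 𝕜 d q) (hM' : M' ∈ rowDegreeLE 𝕜 d q) {k : ℕ} (hk : 1 ≤ k)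
    (hle : k * p + ∑ i, d i ≤ k * q)
    (h : norm2 (trimmed d 1 M - trimmed d 1 M')
      < sigma (k * p + ∑ i, d i) (trimmed d k M) / √(k : ℝ))
    (y : EuclideanSpace 𝕜 ((i : Fin p) × Fin (k + d i))) :
    ∃ x, Matrix.toEuclideanLin (trimmed d k M') x = y ∧
      (sigma (k * p + ∑ i, d i) (trimmed d k M)
        - √(k : ℝ) * norm2 (trimmed d 1 M - trimmed d 1 M')) * ‖x‖ ≤ ‖y‖ := by
  have hk0 : (0 : ℝ) < √(k : ℝ) := Real.sqrt_pos.2 (by exact_mod_cast hk)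
  rw [lt_div_iff₀ hk0, mul_comm] at h
  exact exists_preimage_of_perturbation (Matrix.toEuclideanLin (trimmed d k M))
    (Matrix.toEuclideanLin (trimmed d k M')) (P := k * p + ∑ i, d i)
    (by rw [finrank_euclideanSpace, card_trimmed_rows]) (by simpa using hle)
    (norm_toEuclideanLin_trimmed_sub_le hM hM' k) h y

theorem surjAt_of_norm2_sub_lt {d : Fin p → ℕ} {M M' : Matrix (Fin p) (Fin q) 𝕜[X]}
    (hM : M ∈ rowDegreeLE 𝕜 d q) (hM' : M' ∈ rowDegreeLE 𝕜 d q) {k : ℕ} (hk : 1 ≤ k)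
    (hle : k * p + ∑ i, d i ≤ k * q)
    (h : norm2 (trimmed d 1 M - trimmed d 1 M')
      < sigma (k * p + ∑ i, d i) (trimmed d k M) / √(k : ℝ)) : SurjAt d k M' := by
  rw [surjAt_iff hM']
  intro y
  obtain ⟨x, hx, -⟩ := exists_preimage_trimmed hM hM' hk hle h (WithLp.toLp 2 y)
  exact ⟨WithLp.ofLp x, congrArg WithLp.ofLp hx⟩

/-- The sum of the squares of the moduli of the first `k` coefficients of a polynomial vector. -/
noncomputable def coeffNormSq (k : ℕ) (v : Fin q → 𝕜[X]) : ℝ :=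
  ∑ r ∈ Finset.range k, ∑ j, ‖(v j).coeff r‖ ^ 2

theorem norm_toLp_coeffs_sq (k : ℕ) (v : Fin q → 𝕜[X]) :
    ‖(WithLp.toLp 2 (coeffs k v) : EuclideanSpace 𝕜 (Fin k × Fin q))‖ ^ 2 = coeffNormSq k v := by
  rw [EuclideanSpace.norm_sq_eq, Fintype.sum_prod_type, coeffNormSq, Finset.sum_range]
  rfl

theorem coeffNormSq_eq_of_le {k l : ℕ} {v : Fin q → 𝕜[X]} (hv : ∀ j, v j ∈ degreeLT 𝕜 k)
    (hkl : k ≤ l) : coeffNormSq l v = coeffNormSq k v := by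
  refine (Finset.sum_subset (Finset.range_mono hkl) fun r _ hr => ?_).symm
  refine Finset.sum_eq_zero fun j _ => ?_
  rw [mem_degreeLT_iff_coeff.1 (hv j) r (by simpa using hr)]
  simp

/-- Solve `T' x = T' y`, where `y` holds the coefficients of `v`, and take `v' = v - x`. The right
side is small because `T y = 0`. Since `2ε ≤ θ`, the denominator `σ - √k ε` is at least `√k θ / 2`,
which produces the constant `2 / θ`. -/
theorem exists_null_vector_near {d : Fin p → ℕ} {M M' : Matrix (Fin p) (Fin q) 𝕜[X]}
    (hM : M ∈ rowDegreeLE 𝕜 d q) (hM' : M' ∈ rowDegreeLE 𝕜 d q) {k : ℕ} (hk : 1 ≤ k)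
    (hle : k * p + ∑ i, d i ≤ k * q) {θ : ℝ} (hθ : 0 < θ)
    (hθle : θ ≤ sigma (k * p + ∑ i, d i) (trimmed d k M) / √(k : ℝ))
    (h : 2 * norm2 (trimmed d 1 M - trimmed d 1 M') ≤ θ)
    {v : Fin q → 𝕜[X]} (hv : ∀ j, v j ∈ degreeLT 𝕜 k) (hMv : M.mulVec v = 0) :
    ∃ v' : Fin q → 𝕜[X], (∀ j, v' j ∈ degreeLT 𝕜 k) ∧ M'.mulVec v' = 0 ∧
      coeffNormSq k (v - v')
        ≤ (2 / θ * norm2 (trimmed d 1 M - trimmed d 1 M')) ^ 2 * coeffNormSq k v := by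
  set ε := norm2 (trimmed d 1 M - trimmed d 1 M') with hε
  have hk0 : (0 : ℝ) < √(k : ℝ) := Real.sqrt_pos.2 (by exact_mod_cast hk)
  have hε0 : 0 ≤ ε := norm2_nonneg _
  set y : EuclideanSpace 𝕜 (Fin k × Fin q) := WithLp.toLp 2 (coeffs k v) with hy
  obtain ⟨x, hx, hxle⟩ := exists_preimage_trimmed hM hM' hk hle (by linarith)
    (Matrix.toEuclideanLin (trimmed d k M') y)
  have hx0 : (trimmed d k M').mulVec (coeffs k v - WithLp.ofLp x) = 0 := by
    have h1 : (trimmed d k M').mulVec (WithLp.ofLp x) = (trimmed d k M').mulVec (coeffs k v) :=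
      congrArg WithLp.ofLp hx
    rw [Matrix.mulVec_sub, h1, sub_self]
  have hy0 : Matrix.toEuclideanLin (trimmed d k M) y = 0 := by
    rw [Matrix.toLpLin_apply, hy, (trimmed_mulVec_eq_zero_iff hM _).2
      (by rwa [ofCoeffs_coeffs hv])]
    rfl
  have hnorm : ‖Matrix.toEuclideanLin (trimmed d k M') y‖ ≤ √(k : ℝ) * ε * ‖y‖ := by
    have h1 := norm_toEuclideanLin_trimmed_sub_le hM hM' k y
    rwa [LinearMap.sub_apply, hy0, zero_sub, norm_neg] at h1
  refine ⟨ofCoeffs (coeffs k v - WithLp.ofLp x), ofCoeffs_mem _,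
    (trimmed_mulVec_eq_zero_iff hM' _).1 hx0, ?_⟩
  have hxx : coeffs k (v - ofCoeffs (coeffs k v - WithLp.ofLp x)) = WithLp.ofLp x := by
    have h1 : coeffs k (v - ofCoeffs (coeffs k v - WithLp.ofLp x))
        = coeffs k v - coeffs k (ofCoeffs (coeffs k v - WithLp.ofLp x)) := by
      ext c
      simp only [coeffs, Pi.sub_apply, coeff_sub]
    rw [h1, coeffs_ofCoeffs, sub_sub_cancel]
  rw [← norm_toLp_coeffs_sq, ← norm_toLp_coeffs_sq, hxx, ← mul_pow, ← hy]
  refine pow_le_pow_left₀ (norm_nonneg _) ?_ 2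
  change ‖x‖ ≤ _
  rw [le_div_iff₀ hk0] at hθle
  have h1 : √(k : ℝ) * (θ / 2) * ‖x‖ ≤ √(k : ℝ) * (ε * ‖y‖) := by
    calc √(k : ℝ) * (θ / 2) * ‖x‖
        ≤ (sigma (k * p + ∑ i, d i) (trimmed d k M) - √(k : ℝ) * ε) * ‖x‖ := by
          refine mul_le_mul_of_nonneg_right ?_ (norm_nonneg _)
          nlinarith
      _ ≤ √(k : ℝ) * ε * ‖y‖ := hxle.trans hnorm
      _ = _ := by ring
  rw [mul_assoc] at h1
  have h2 := le_of_mul_le_mul_left h1 hk0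
  rw [div_mul_eq_mul_div, div_mul_eq_mul_div, le_div_iff₀ hθ]
  linarith

end Trimmed

end SingularValues

/-! ### Frobenius norms of `S_1`, the constants `θ₁` and `θ₂`, and the main theorem. -/

section Perturbation

variable {𝕜 : Type*} [RCLike 𝕜] {m n p q : ℕ}

theorem sylvesterMat_sub (e k : ℕ) (P Q : Matrix (Fin p) (Fin q) 𝕜[X]) :
    sylvesterMat e k (P - Q) = sylvesterMat e k P - sylvesterMat e k Q := by
  ext r c
  simp only [sylvesterMat, Matrix.of_apply, Matrix.sub_apply, coeff_sub]
  split_ifs <;> simp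

theorem normF_sylvesterMat_one_sq (e : ℕ) (P : Matrix (Fin p) (Fin q) 𝕜[X]) :
    normF (sylvesterMat e 1 P) ^ 2 = ∑ i, coeffNormSq (e + 1) (P i) := by
  rw [normF_sq]
  simp only [coeffNormSq, Fintype.sum_prod_type, sylvesterMat, Matrix.of_apply]
  rw [Finset.sum_comm]
  refine Finset.sum_congr rfl fun i _ => ?_
  rw [add_comm e 1, Finset.sum_range]
  simp

/-- The degree picked may vary with the row, so this covers both `N_hr` and the coefficients of `N -
N'` in the row degrees of `N`. -/
theorem normF_coeff_le {e : Fin p → ℕ} {K : ℕ} (he : ∀ i, e i ≤ K)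
    (P : Matrix (Fin p) (Fin q) 𝕜[X]) :
    normF (Matrix.of fun i j => (P i j).coeff (e i)) ≤ normF (sylvesterMat K 1 P) := by
  refine le_of_sq_le_sq ?_ (normF_nonneg _)
  rw [normF_sylvesterMat_one_sq, normF_sq]
  refine Finset.sum_le_sum fun i _ => ?_
  exact Finset.single_le_sum (f := fun r => ∑ j, ‖(P i j).coeff r‖ ^ 2)
    (fun r _ => Finset.sum_nonneg fun j _ => sq_nonneg _)
    (Finset.mem_range.2 (Nat.lt_succ_of_le (he i)))

theorem theta_bounds {d : Fin m → ℕ} (hk : 1 ≤ kPrime n d)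
    (M : Matrix (Fin m) (Fin (m + n)) 𝕜[X]) :
    theta1 d M ≤ theta2 d M ∧
    theta1 d M ≤ sigma (kPrime n d * m + ∑ i, d i) (trimmed d (kPrime n d) M)
      / √(kPrime n d : ℝ) ∧
    theta2 d M ≤ sigma ((kPrime n d + 1) * m + ∑ i, d i) (trimmed d (kPrime n d + 1) M)
      / √((kPrime n d + 1 : ℕ) : ℝ) ∧
    (tPrime n d ≠ 0 → theta2 d M ≤ sigma (kPrime n d * m + ∑ i, d i)
      (trimmed d (kPrime n d) M) / √(kPrime n d : ℝ)) ∧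
    (tPrime n d ≠ 0 → 2 ≤ kPrime n d → theta1 d M ≤
      sigma ((kPrime n d - 1) * (m + n)) (trimmed d (kPrime n d - 1) M)
        / √((kPrime n d - 1 : ℕ) : ℝ)) := by
  simp only [theta1, theta2]
  generalize kPrime n d = k at *
  rw [add_one_mul]
  push_cast [Nat.cast_sub hk]
  by_cases ht : tPrime n d = 0
  · simp [ht]
  · by_cases hk1 : k = 1
    · subst hk1
      simp [ht, ← two_mul]
    · simp [ht, hk1]

end Perturbation

end TrimmedSylvester

theorem mainTheorem6 {𝕜 : Type*} [RCLike 𝕜] {m n : ℕ} (hn : 0 < n) (d : Fin m → ℕ)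
    (hd : ∃ i, 0 < d i)
    (M : Matrix (Fin m) (Fin (m + n)) 𝕜[X]) (hM : M ∈ rowDegreeLE 𝕜 d (m + n))
    (hfull : FullTrimmedSylvesterRank d M)
    (N : Matrix (Fin n) (Fin (m + n)) 𝕜[X]) (hN : N ∈ matDegreeLE 𝕜 n (m + n) (kPrime n d))
    (hdual : DualMinimalBases M N) :
    (∀ M' ∈ rowDegreeLE 𝕜 d (m + n),
      norm2 (trimmed d 1 M - trimmed d 1 M') <
        1 / 2 * theta1 d M *
          (sigma n (highestRowDegreeCoeff N) / normF (sylvesterMat (kPrime n d) 1 N)) →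
      FullTrimmedSylvesterRank d M' ∧
      ∃ N' ∈ matDegreeLE 𝕜 n (m + n) (kPrime n d),
        DualMinimalBases M' N' ∧
        normF (sylvesterMat (kPrime n d) 1 N - sylvesterMat (kPrime n d) 1 N') /
            normF (sylvesterMat (kPrime n d) 1 N) ≤
          2 / theta2 d M * norm2 (trimmed d 1 M - trimmed d 1 M') ∧
        (tPrime n d = 0 → ∀ j, vecDegree (N' j) = kPrime n d)) ∧
    (tPrime n d = 0 → ∀ j, vecDegree (N j) = kPrime n d) := by
  obtain ⟨hnk, htn⟩ := n_mul_kPrime hn d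
  have hk : 1 ≤ kPrime n d := by
    obtain ⟨i, hi⟩ := hd
    have hD : 0 < ∑ i, d i := Finset.sum_pos' (fun _ _ => Nat.zero_le _) ⟨i, Finset.mem_univ _, hi⟩
    by_contra h
    rw [show kPrime n d = 0 by omega] at hnk
    omega
  obtain ⟨hθ12, hθ1a, hθ2b, hθ2a, hθ1c⟩ := theta_bounds hk M
  obtain ⟨hMmin, hNmin, hMN⟩ := hdual
  rw [mul_transpose_eq_zero_iff] at hMN
  obtain ⟨hs, hi, hi0⟩ := (fullTrimmedSylvesterRank_iff hn hd hM).1 hfull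
  have hle : ∀ k, kPrime n d ≤ k → k * m + ∑ i, d i ≤ k * (m + n) := fun k hkk => by
    have : n * kPrime n d ≤ n * k := Nat.mul_le_mul_left n hkk
    rw [mul_add, mul_comm k n]
    omega
  have hNk : ∀ j, vecDegree (N j) ≤ kPrime n d := fun j => vecDegree_le_iff.2 (hN j)
  have hNge : ∀ j, kPrime n d - 1 ≤ vecDegree (N j) := fun j =>
    hi.le_vecDegree (hNmin.1.row_ne_zero j) (hMN j)
  have hNt : tPrime n d = 0 → ∀ j, vecDegree (N j) = kPrime n d := fun ht j =>
    (hNk j).antisymm ((hi0 ht).le_vecDegree (hNmin.1.row_ne_zero j) (hMN j))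
  refine ⟨fun M' hM' hlt => ?_, hNt⟩
  set k' := kPrime n d
  set S := sylvesterMat k' 1 N
  set ε := norm2 (trimmed d 1 M - trimmed d 1 M')
  set θ₁ := theta1 d M
  set θ₂ := theta2 d M
  set σ := sigma n (highestRowDegreeCoeff N)
  have hε0 : 0 ≤ ε := norm2_nonneg _
  have hσ0 : 0 ≤ σ := sigma_nonneg _ _
  have hS0 : 0 ≤ normF S := normF_nonneg _
  have hσS : σ ≤ normF S := (sigma_le_normF hn (Nat.le_add_left n m) _).trans (normF_coeff_le hNk N)
  have hρ1 : σ / normF S ≤ 1 := div_le_one_of_le₀ hσS hS0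
  have hρ0 : 0 ≤ σ / normF S := div_nonneg hσ0 hS0
  have hpos : 0 < 1 / 2 * θ₁ * (σ / normF S) := hε0.trans_lt hlt
  -- The strict hypothesis on `ε` already forces `σ`, `θ₁` and `normF S` to be positive, division by
  -- zero being zero.
  have hρ : 0 < σ / normF S := hρ0.lt_of_ne fun h => by
    rw [← h, mul_zero] at hpos
    exact lt_irrefl _ hpos
  have hθ₁ : 0 < θ₁ := by
    have := pos_of_mul_pos_left hpos hρ0
    linarith
  have hθ₂ : 0 < θ₂ := hθ₁.trans_le hθ12
  have hS : 0 < normF S := hS0.lt_of_ne fun h => by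
    rw [← h, div_zero] at hρ
    exact lt_irrefl _ hρ
  have hεθ : 2 * ε < θ₁ := by
    have : 1 / 2 * θ₁ * (σ / normF S) ≤ 1 / 2 * θ₁ * 1 :=
      mul_le_mul_of_nonneg_left hρ1 (by linarith)
    linarith
  have hs' : SurjAt d k' M' := surjAt_of_norm2_sub_lt hM hM' hk (hle _ le_rfl) (by linarith)
  have hi0' : tPrime n d = 0 → InjAt k' M' := fun ht => by
    refine injAt_of_norm2_sub_lt hM hM' hk ?_
    -- For `t = 0` the matrix `T_{k'}` is square, so the term `a` of `θ₁` also gives injectivity.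
    rw [show k' * (m + n) = k' * m + ∑ i, d i by rw [mul_add, mul_comm k' n]; omega]
    linarith
  have hi' : InjAt (k' - 1) M' := by
    by_cases ht : tPrime n d = 0
    · exact (hi0' ht).mono (Nat.sub_le _ _)
    rcases Nat.lt_or_ge k' 2 with hk2 | hk2
    · intro v hv _
      ext j r
      exact mem_degreeLT_iff_coeff.1 (hv j) r (by omega)
    · have := hθ1c ht hk2
      exact injAt_of_norm2_sub_lt hM hM' (by omega) (by linarith)
  obtain ⟨N', hN'⟩ : ∃ N' : Matrix (Fin n) (Fin (m + n)) 𝕜[X], ∀ j,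
      (∀ l, N' j l ∈ degreeLT 𝕜 (vecDegree (N j) + 1)) ∧ M'.mulVec (N' j) = 0 ∧
        coeffNormSq (vecDegree (N j) + 1) (N j - N' j)
          ≤ (2 / θ₂ * ε) ^ 2 * coeffNormSq (vecDegree (N j) + 1) (N j) := by
    suffices h : ∀ j, ∃ v : Fin (m + n) → 𝕜[X],
        (∀ l, v l ∈ degreeLT 𝕜 (vecDegree (N j) + 1)) ∧ M'.mulVec v = 0 ∧
          coeffNormSq (vecDegree (N j) + 1) (N j - v)
            ≤ (2 / θ₂ * ε) ^ 2 * coeffNormSq (vecDegree (N j) + 1) (N j) from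
      ⟨fun j => (h j).choose, fun j => (h j).choose_spec⟩
    intro j
    have h1 := hNk j
    have h2 := hNge j
    refine exists_null_vector_near hM hM' (Nat.le_add_left _ _) (hle _ (by omega)) hθ₂ ?_
      (by linarith) (vecDegree_le_iff_mem.1 le_rfl) (hMN j)
    rcases h1.eq_or_lt with h3 | h3
    · rw [h3]
      exact hθ2b
    -- A row of degree `k' - 1` occurs only for `t > 0`, and then `θ₂` includes the term `a`.
    · rw [show vecDegree (N j) + 1 = k' by omega]
      exact hθ2a fun ht => h3.ne (hNt ht j)
  have hMN' : ∀ j, M'.mulVec (N' j) = 0 := fun j => (hN' j).2.1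
  have hN'deg : ∀ j, vecDegree (N' j) ≤ vecDegree (N j) := fun j =>
    vecDegree_le_iff_mem.2 (hN' j).1
  have hnear : normF (S - sylvesterMat k' 1 N') ≤ 2 / θ₂ * ε * normF S := by
    refine le_of_sq_le_sq ?_ (by positivity)
    rw [mul_pow, ← sylvesterMat_sub, normF_sylvesterMat_one_sq, normF_sylvesterMat_one_sq,
      Finset.mul_sum]
    refine Finset.sum_le_sum fun j _ => ?_
    have h1 : ∀ l, N j l ∈ degreeLT 𝕜 (vecDegree (N j) + 1) := vecDegree_le_iff_mem.1 le_rfl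
    have h2 : ∀ l, N' j l ∈ degreeLT 𝕜 (vecDegree (N j) + 1) :=
      vecDegree_le_iff_mem.1 (hN'deg j)
    have h3 := Nat.add_le_add_right (hNk j) 1
    rw [coeffNormSq_eq_of_le h1 h3]
    exact (coeffNormSq_eq_of_le (fun l => Submodule.sub_mem _ (h1 l) (h2 l)) h3).trans_le
      (hN' j).2.2
  have hnear_lt : normF (S - sylvesterMat k' 1 N') < σ := by
    refine hnear.trans_lt ?_
    have h1 : ε < 1 / 2 * θ₂ * (σ / normF S) :=
      hlt.trans_le (mul_le_mul_of_nonneg_right (by linarith) hρ0)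
    calc 2 / θ₂ * ε * normF S < 2 / θ₂ * (1 / 2 * θ₂ * (σ / normF S)) * normF S := by gcongr
      _ = σ := by field_simp
  -- Coefficients of `N'` are taken in the degrees of the rows of `N`, which a priori only bound
  -- those of `N'`.
  have hN'ind : RowsIndependent N' := by
    refine linearIndependent_of_leadingCoeffs (e := fun j => vecDegree (N j))
      (fun j => vecDegree_le_iff_mem.1 (hN'deg j)) ?_
    refine linearIndependent_rows_of_normF_sub_lt (Nat.le_add_left n m) (highestRowDegreeCoeff N)
      (Matrix.of fun j l => (N' j l).coeff (vecDegree (N j))) (lt_of_le_of_lt ?_ hnear_lt)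
    rw [← sylvesterMat_sub]
    refine le_trans (le_of_eq ?_) (normF_coeff_le hNk (N - N'))
    congr 1
    ext j l
    simp [highestRowDegreeCoeff]
  have hsum : ∑ j, vecDegree (N' j) ≤ ∑ i, d i :=
    (Finset.sum_le_sum fun j _ => hN'deg j).trans (hNmin.sum_vecDegree_le hM hk hs hi hMN hNk)
  refine ⟨(fullTrimmedSylvesterRank_iff hn hd hM').2 ⟨hs', hi', hi0'⟩, N',
    fun j => vecDegree_le_iff.1 ((hN'deg j).trans (hNk j)),
    ⟨hs'.isMinimalBasis hM' hk, isMinimalBasis_of_mulVec_eq_zero hM' hk hs' hN'ind hMN' hsum,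
      mul_transpose_eq_zero_iff.2 hMN'⟩, (div_le_iff₀ hS).2 hnear, fun ht j => ?_⟩
  exact ((hN'deg j).trans (hNk j)).antisymm
    ((hi0' ht).le_vecDegree (hN'ind.row_ne_zero j) (hMN' j))
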